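/- Let $d\ge 3$ be an odd integer and let $\mathbb{T}^d=\mathbb{R}^d/2\pi\mathbb{Z}^d$ be the flat torus. Let $x,y\in\mathbb{R}^d$ project to distinct points of $\mathbb{T}^d$. Let $\beta=\beta_0+df$ be a closed real-valued one-form on $\mathbb{T}^d$, where $\beta_0=\sum_{j}\beta_{0,j}\,dx_j$ is identified with the vector $(\beta_{0,1},\dots,\beta_{0,d})\in\mathbb{R}^d$ and $f$ is a smooth real-valued $2\pi\mathbb{Z}^d$-periodic function, and assume that $\beta_0\notin\mathbb{Z}^d$. Let $\mathcal{P}_{x,y}$ be the set of geodesic arcs of $\mathbb{T}^d$ (parametrized by arc length) going from $x$ to $y$, let $\ell(\gamma)$ be the length of $\gamma$, and set $$\mu_{GM}(t)=\sum_{\gamma\in\mathcal{P}_{x,y}}\frac{e^{i\int_\gamma\beta}}{\ell(\gamma)}\big(\delta(t-\ell(\gamma))-\delta(t+\ell(\gamma))\big).$$ Then this series converges in $\mathcal{S}'(\mathbb{R})$, and, with the convention $\widehat{\varphi}(\tau)=\int_{\mathbb{R}}e^{-i\tau t}\varphi(t)\,dt$ extended to $\mathcal{S}'(\mathbb{R})$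 by duality, the Fourier transform of $\mu_{GM}$ is $$\widehat{\mu}_{GM}(\tau)=-i\,\pi^{-\frac{d-1}{2}}\,e^{i(f(y)-f(x))}\sum_{\xi\in\mathbb{Z}^d}e^{i\xi\cdot(x-y)}\left(\frac{\delta^{(\frac{d-3}{2})}(\tau-|\xi+\beta_0|)}{(\tau+|\xi+\beta_0|)^{\frac{d-1}{2}}}+\frac{\delta^{(\frac{d-3}{2})}(\tau+|\xi+\beta_0|)}{(\tau-|\xi+\beta_0|)^{\frac{d-1}{2}}}\right),$$ where the sum converges in $\mathcal{S}'(\mathbb{R})$ and each quotient is the product of a derivative of a Dirac mass with a function that is smooth near its support, i.e. $\langle g\,\delta^{(k)}(\cdot-a),\varphi\rangle=(-1)^k(g\varphi)^{(k)}(a)$. Consequently $\mu_{GM}$ is a crystalline distribution: a tempered distribution on $\mathbb{R}$ carried by a discrete, locally finite set whose Fourier transform is also carried by a discrete, locally finite set. -/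

import Mathlib

open scoped SchwartzMap ContDiff FourierTransform

noncomputable section

namespace GuinandMeyer

/-- The lattice `2πℤ^d` in `ℝ^d`. -/
def periodLattice (d : ℕ) : AddSubgroup (EuclideanSpace ℝ (Fin d)) where
  carrier := {v | ∃ n : Fin d → ℤ, ∀ i, v i = 2 * Real.pi * n i}
  add_mem' := by
    rintro v w ⟨n, hn⟩ ⟨m, hm⟩
    exact ⟨n + m, fun i => by simp [hn i, hm i, mul_add]⟩
  zero_mem' := ⟨0, fun i => by simp⟩
  neg_mem' := by
    rintro v ⟨n, hn⟩
    exact ⟨-n, fun i => by simp [hn i]⟩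

/-- The flat torus `𝕋^d = ℝ^d / 2πℤ^d`. -/
abbrev FlatTorus (d : ℕ) : Type := EuclideanSpace ℝ (Fin d) ⧸ periodLattice d

/-- The canonical projection `ℝ^d → 𝕋^d`. -/
def proj {d : ℕ} (x : EuclideanSpace ℝ (Fin d)) : FlatTorus d := QuotientAddGroup.mk x

/-- The set of all geodesic arcs of positive length on `𝕋^d`, parametrized by arc length, that go
from (the projection of) `x` to (the projection of) `y`: the arc with length `ℓ` and unit initial
direction `θ` is the curve `t ↦ proj (x + t θ)`, `0 ≤ t ≤ ℓ`. -/
@[ext]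
structure GeodesicArc {d : ℕ} (x y : EuclideanSpace ℝ (Fin d)) where
  /-- the length of the arc -/
  length : ℝ
  length_pos : 0 < length
  /-- the (constant) unit velocity of the arc -/
  dir : EuclideanSpace ℝ (Fin d)
  norm_dir : ‖dir‖ = 1
  endpoint : proj (x + length • dir) = proj y

/-- The integral `∫_γ β` of a one-form `β` (a one-form on the torus is a `2πℤ^d`-periodic one-form
on `ℝ^d`) along the geodesic arc `γ`. -/
def GeodesicArc.integral {d : ℕ} {x y : EuclideanSpace ℝ (Fin d)} (γ : GeodesicArc x y)
    (β : EuclideanSpace ℝ (Fin d) → (EuclideanSpace ℝ (Fin d) →L[ℝ] ℝ)) : ℝ :=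
  ∫ t in (0 : ℝ)..γ.length, β (x + t • γ.dir) γ.dir

/-- The summand `e^{i∫_γ β} / ℓ(γ) · (δ(t - ℓ(γ)) - δ(t + ℓ(γ)))`. -/
def muTerm {d : ℕ} {x y : EuclideanSpace ℝ (Fin d)}
    (β : EuclideanSpace ℝ (Fin d) → (EuclideanSpace ℝ (Fin d) →L[ℝ] ℝ))
    (γ : GeodesicArc x y) : 𝓢'(ℝ, ℂ) :=
  (Complex.exp (Complex.I * (γ.integral β : ℂ)) / (γ.length : ℂ)) •
    (TemperedDistribution.delta γ.length - TemperedDistribution.delta (-γ.length))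

/-- The distribution `μ_GM`, the sum of the terms `muTerm` over all geodesic arcs from `x` to `y`
(the sum is taken in the space of tempered distributions). -/
def muGM {d : ℕ} (β : EuclideanSpace ℝ (Fin d) → (EuclideanSpace ℝ (Fin d) →L[ℝ] ℝ))
    (x y : EuclideanSpace ℝ (Fin d)) : 𝓢'(ℝ, ℂ) :=
  ∑' γ : GeodesicArc x y, muTerm β γ

/-- The Fourier transform `φ̂(t) = ∫ e^{-itτ} φ(τ) dτ` on Schwartz functions, which is Mathlib's
Fourier transform (with kernel `e^{-2πitτ}`) at `t / (2π)`. -/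
def schwartzFourier : 𝓢(ℝ, ℂ) →L[ℂ] 𝓢(ℝ, ℂ) :=
  (SchwartzMap.compCLMOfContinuousLinearEquiv ℂ
    (ContinuousLinearEquiv.unitsEquivAut ℝ
      (Units.mk0 (2 * Real.pi)⁻¹ (inv_ne_zero Real.two_pi_pos.ne')))).comp
    (FourierTransform.fourierCLM ℂ 𝓢(ℝ, ℂ))

theorem schwartzFourier_apply (φ : 𝓢(ℝ, ℂ)) (t : ℝ) :
    schwartzFourier φ t = ∫ τ : ℝ, Complex.exp (-(Complex.I * t * τ)) * φ τ := by
  simp only [schwartzFourier, ContinuousLinearMap.comp_apply,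
    SchwartzMap.compCLMOfContinuousLinearEquiv_apply, Function.comp,
    FourierTransform.fourierCLM_apply, SchwartzMap.fourier_coe, Real.fourier_real_eq_integral_exp_smul]
  refine MeasureTheory.integral_congr_ae (Filter.Eventually.of_forall fun τ => ?_)
  simp only [ContinuousLinearEquiv.unitsEquivAut_apply, Units.val_mk0, smul_eq_mul]
  congr 2
  have : (Real.pi : ℂ) ≠ 0 := by exact_mod_cast Real.pi_ne_zero
  push_cast
  field_simp

/-- The Fourier transform of a tempered distribution, `⟨T̂, φ⟩ = ⟨T, φ̂⟩`. -/
def distFourier : 𝓢'(ℝ, ℂ) →L[ℂ] 𝓢'(ℝ, ℂ) :=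
  PointwiseConvergenceCLM.precomp ℂ schwartzFourier

theorem distFourier_apply (T : 𝓢'(ℝ, ℂ)) (φ : 𝓢(ℝ, ℂ)) :
    distFourier T φ = T (schwartzFourier φ) := rfl

/-- The pairing `⟨g δ^{(k)}(· - a), φ⟩ = (-1)^k (g φ)^{(k)}(a)` of a test function `φ` with the
product of the `k`-th derivative of the Dirac mass at `a` with a function `g` that is smooth near
`a`. -/
def derivDeltaMul (k : ℕ) (a : ℝ) (g : ℝ → ℂ) (φ : 𝓢(ℝ, ℂ)) : ℂ :=
  (-1) ^ k * iteratedDeriv k (fun τ : ℝ => g τ * φ τ) a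

/-- A closed discrete (equivalently, locally finite) set of real numbers. -/
def IsLocallyFiniteSet (S : Set ℝ) : Prop := ∀ R : ℝ, (S ∩ Set.Icc (-R) R).Finite

/-- A crystalline distribution: a tempered distribution on `ℝ` that is carried by a discrete,
locally finite set and whose Fourier transform has the same property. -/
def IsCrystalline (T : 𝓢'(ℝ, ℂ)) : Prop :=
  IsLocallyFiniteSet (Distribution.dsupport T) ∧
    IsLocallyFiniteSet (Distribution.dsupport (distFourier T))

/-- The vector of `ℝ^d` with the integer coordinates `ξ`. -/
def intVec {d : ℕ} (ξ : Fin d → ℤ) : EuclideanSpace ℝ (Fin d) :=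
  WithLp.toLp 2 fun i => (ξ i : ℝ)

end GuinandMeyer

end

namespace GuinandMeyer

open MeasureTheory Set Filter Topology

/-! ### Lattice sums of inverse powers. -/

section Lattice

variable {ι : Type*} [Fintype ι]

/-! The formula is Poisson summation on `ℤ^d` for a twisted radial function. Write `d = 2j + 1`.
Arcs from `x` to `y` correspond to the displacements `y - x + 2πn`. The exact part of `β`
contributes the constant phase `e^{i(f(y) - f(x))}`, and `β₀` contributes a character. So, after
rescaling by `2π`, pairing `μ_GM` with the transform of `φ` sums over translates of `ℤ^d` a
character times `g₀(|u|)`, where `g₀(r) = h(r)/r` and `h(r) = 𝓕φ(r) - 𝓕φ(-r)`.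

The `d`-dimensional transform of `g₀(|u|)` is computed by integrating over hyperplanes. In polar
coordinates on `ℝ^{2j}` only odd powers of `r` occur, so the integrals are exact along a chain with
`g_{i+1}' = -r g_i`. They give `(2π)^j g_j`, and a one-dimensional transform remains
(`IsRadialChain.integral_euclidean_fourier`).

Since `g₁' = -h`, the transform of `g₁` is `(φ(ρ) - φ(-ρ))/(2πiρ)`, and each further link applies
`-(4π²ρ)⁻¹ d/dρ`. The result is a pair of jets of `φ(τ)/(τ + a)^{k+1}` at `τ = a`, `a = ±ρ`, with `k
= j - 1` (`fourier_chain_eq_quotientJet`). These are the derivatives of Dirac masses in the formula,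
with `ρ = |ξ + β₀|`. The condition `β₀ ∉ ℤ^d` keeps `ρ ≠ 0`, and `proj x ≠ proj y` keeps all lengths
positive.

Both sides are sums of terms living at `±ρ_i` with `ρ_i → ∞`, so the supports are locally finite. -/

theorem summable_norm_sum_smul_sub_inv_pow {E : Type*} [NormedAddCommGroup E] [NormedSpace ℝ E]
    [FiniteDimensional ℝ E] (b : Module.Basis ι ℝ E) (x : E) {N : ℕ} (hN : Fintype.card ι < N) :
    Summable fun n : ι → ℤ => ‖(∑ i, (n i : ℝ) • b i) - x‖⁻¹ ^ N := by
  have hrank : Module.finrank ℤ (Submodule.span ℤ (Set.range b)) = Fintype.card ι :=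
    Module.finrank_eq_card_basis (b.restrictScalars ℤ)
  have h := ZLattice.summable_norm_sub_inv_pow (Submodule.span ℤ (Set.range b)) N
    (by rw [hrank]; exact hN) x
  have h' := h.comp_injective (b.restrictScalars ℤ).equivFun.symm.injective
  refine h'.congr fun n => ?_
  simp [Module.Basis.equivFun_symm_apply, ← Int.cast_smul_eq_zsmul ℝ]

theorem summable_norm_intCast_add_inv_pow (x : ι → ℝ) {N : ℕ} (hN : Fintype.card ι < N) :
    Summable fun n : ι → ℤ => ‖(fun i => (n i : ℝ)) + x‖⁻¹ ^ N := by
  classical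
  refine (summable_norm_sum_smul_sub_inv_pow (Pi.basisFun ℝ ι) (-x) hN).congr fun n => ?_
  congr 3
  rw [sub_neg_eq_add]
  congr 1
  ext i
  simp [Finset.sum_apply, Pi.single_apply]

theorem summable_one_add_norm_intCast_inv_pow {N : ℕ} (hN : Fintype.card ι < N) :
    Summable fun n : ι → ℤ => ((1 + ‖fun i => (n i : ℝ)‖) ^ N)⁻¹ := by
  refine Summable.of_norm_bounded_eventually
    (summable_norm_intCast_add_inv_pow (0 : ι → ℝ) hN) ?_
  refine (Set.finite_singleton (0 : ι → ℤ)).subset fun n hn => ?_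
  by_contra h0
  apply hn
  have : (fun i => (n i : ℝ)) ≠ 0 := fun h => h0 (funext fun i => by simpa using congrFun h i)
  have hp := norm_pos_iff.2 this
  change ‖((1 + ‖fun i => (n i : ℝ)‖) ^ N)⁻¹‖ ≤ ‖(fun i => (n i : ℝ)) + 0‖⁻¹ ^ N
  rw [Real.norm_of_nonneg (by positivity), add_zero, inv_pow]
  gcongr
  linarith

end Lattice

/-! ### Periodization and Poisson summation under polynomial decay. -/

section Poisson

variable {ι : Type*}

/-- The `ℤ^ι`-periodization of `F`. -/
noncomputable def periodization (F : (ι → ℝ) → ℂ) (u : ι → ℝ) : ℂ :=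
  ∑' n : ι → ℤ, F (u + fun i => (n i : ℝ))

theorem periodization_add_intCast (F : (ι → ℝ) → ℂ) (u : ι → ℝ) (m : ι → ℤ) :
    periodization F (u + fun i => (m i : ℝ)) = periodization F u := by
  unfold periodization
  rw [← (Equiv.addLeft m).tsum_eq fun n : ι → ℤ => F (u + fun i => (n i : ℝ))]
  refine tsum_congr fun n => ?_
  congr 1
  ext i
  simp [add_assoc]

/-- A product of open quotient maps is an open quotient map, so `ℝ^ι → 𝕋^ι` is a quotient map and
continuous periodic functions descend. -/
theorem exists_continuousMap_unitAddTorus {P : (ι → ℝ) → ℂ} (hP : Continuous P)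
    (hper : ∀ (u : ι → ℝ) (m : ι → ℤ), P (u + fun i => (m i : ℝ)) = P u) :
    ∃ f : C(UnitAddTorus ι, ℂ), ∀ u : ι → ℝ, f (fun i => (u i : UnitAddCircle)) = P u := by
  let π : C(ι → ℝ, UnitAddTorus ι) :=
    ⟨fun u i => (u i : UnitAddCircle), continuous_pi fun i =>
      (AddCircle.continuous_mk' 1).comp (continuous_apply i)⟩
  have hq : IsQuotientMap π := IsOpenQuotientMap.isQuotientMap
    (IsOpenQuotientMap.piMap fun _ => QuotientAddGroup.isOpenQuotientMap_mk)
  have hfac : Function.FactorsThrough (⟨P, hP⟩ : C(ι → ℝ, ℂ)) π := by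
    intro u v h
    have : ∀ i, ∃ m : ℤ, u i = v i + m := fun i => by
      have hi : (u i : UnitAddCircle) = v i := congrFun h i
      rw [← sub_eq_zero, ← AddCircle.coe_sub, AddCircle.coe_eq_zero_iff] at hi
      obtain ⟨m, hm⟩ := hi
      refine ⟨m, ?_⟩
      rw [zsmul_eq_mul, mul_one] at hm
      rw [hm]
      ring
    choose m hm using this
    rw [show u = v + fun i => (m i : ℝ) from funext hm]
    exact hper v m
  exact ⟨hq.lift ⟨P, hP⟩ hfac, fun u => DFunLike.congr_fun (hq.lift_comp ⟨P, hP⟩ hfac) u⟩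

variable [Fintype ι]

theorem one_add_norm_le_mul {E : Type*} [SeminormedAddCommGroup E] (u v : E) :
    1 + ‖v‖ ≤ (1 + ‖u‖) * (1 + ‖u + v‖) := by
  have : ‖v‖ ≤ ‖u‖ + ‖u + v‖ := by
    simpa [add_comm] using norm_le_add_norm_add v u
  nlinarith [norm_nonneg u, norm_nonneg (u + v)]

/-- Peetre-type comparison: it dominates lattice translates uniformly for `u` in a ball. -/
theorem inv_one_add_norm_add_pow_le {E : Type*} [SeminormedAddCommGroup E] {u v : E} {R : ℝ}
    (hu : ‖u‖ ≤ R) (N : ℕ) : ((1 + ‖u + v‖) ^ N)⁻¹ ≤ (1 + R) ^ N * ((1 + ‖v‖) ^ N)⁻¹ := by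
  have h1 : 1 + ‖v‖ ≤ (1 + R) * (1 + ‖u + v‖) :=
    (one_add_norm_le_mul u v).trans (by gcongr)
  rw [← div_eq_mul_inv, le_div_iff₀ (by positivity), inv_mul_le_iff₀ (by positivity), ← mul_pow,
    mul_comm]
  exact pow_le_pow_left₀ (by positivity) (by linarith) N

variable {F : (ι → ℝ) → ℂ} {C : ℝ} {N : ℕ}

theorem norm_le_of_decay (hF : ∀ u, ‖F u‖ ≤ C * ((1 + ‖u‖) ^ N)⁻¹) {u : ι → ℝ} {R : ℝ}
    (hu : ‖u‖ ≤ R) (v : ι → ℝ) : ‖F (u + v)‖ ≤ C * (1 + R) ^ N * ((1 + ‖v‖) ^ N)⁻¹ := by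
  have hC : 0 ≤ C := by simpa using (norm_nonneg _).trans (hF 0)
  rw [mul_assoc]
  exact (hF _).trans (mul_le_mul_of_nonneg_left (inv_one_add_norm_add_pow_le hu N) hC)

theorem continuous_periodization (hFc : Continuous F)
    (hF : ∀ u, ‖F u‖ ≤ C * ((1 + ‖u‖) ^ N)⁻¹) (hN : Fintype.card ι < N) :
    Continuous (periodization F) := by
  refine continuous_iff_continuousAt.2 fun u => ?_
  have : ContinuousOn (periodization F) (Metric.ball 0 (‖u‖ + 1)) := by
    refine continuousOn_tsum (fun n => by fun_prop)
      ((summable_one_add_norm_intCast_inv_pow hN).mul_left (C * (1 + (‖u‖ + 1)) ^ N))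
      fun n v hv => norm_le_of_decay hF ?_ _
    simpa using (mem_ball_zero_iff.1 hv).le
  exact this.continuousAt (Metric.isOpen_ball.mem_nhds (by simp))

theorem mFourier_apply_coe (n : ι → ℤ) (u : ι → ℝ) :
    UnitAddTorus.mFourier n (fun i => (u i : UnitAddCircle)) =
      Complex.exp (2 * Real.pi * Complex.I * ∑ i, (n i : ℂ) * u i) := by
  simp only [UnitAddTorus.mFourier, ContinuousMap.coe_mk, fourier_coe_apply, Finset.mul_sum,
    Complex.exp_sum]
  refine Finset.prod_congr rfl fun i _ => ?_
  congr 1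
  push_cast
  ring

/-- Half-open unit cubes tile `ℝ^ι`: `u` lies in exactly one, indexed by `⌈u i⌉ - 1`. -/
theorem hasSum_setIntegral_intCast_translate {G : (ι → ℝ) → ℂ} (hG : Integrable G) :
    HasSum (fun n : ι → ℤ => ∫ u in {u : ι → ℝ | ∀ i, u i ∈ Ioc (0 : ℝ) (0 + 1)},
      G (u + fun i => (n i : ℝ))) (∫ u, G u) := by
  set B : Set (ι → ℝ) := {u : ι → ℝ | ∀ i, u i ∈ Ioc (0 : ℝ) (0 + 1)} with hB
  let S : (ι → ℤ) → Set (ι → ℝ) := fun n => {u | ∀ i, u i - n i ∈ Ioc (0 : ℝ) (0 + 1)}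
  have hS : ∀ n u, u ∈ S n ↔ ∀ i, n i = ⌈u i⌉ - 1 := by
    intro n u
    refine forall_congr' fun i => ?_
    rw [eq_sub_iff_add_eq, eq_comm, Int.ceil_eq_iff, mem_Ioc]
    push_cast
    constructor <;> rintro ⟨h1, h2⟩ <;> constructor <;> linarith
  have hmeas : ∀ n, MeasurableSet (S n) := fun n => by
    have : S n = ⋂ i, (fun u : ι → ℝ => u i - n i) ⁻¹' Ioc (0 : ℝ) (0 + 1) := by
      ext u; simp [S]
    rw [this]
    exact MeasurableSet.iInter fun i => measurableSet_Ioc.preimage (by fun_prop)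
  have hdisj : Pairwise (Function.onFun Disjoint S) := fun n m hnm => by
    refine Set.disjoint_left.2 fun u hu hu' => hnm ?_
    rw [hS] at hu hu'
    exact funext fun i => (hu i).trans (hu' i).symm
  have hunion : ⋃ n, S n = univ :=
    eq_univ_of_forall fun u => mem_iUnion.2 ⟨fun i => ⌈u i⌉ - 1, (hS _ _).2 fun i => rfl⟩
  have h := hasSum_integral_iUnion hmeas hdisj hG.integrableOn
  rw [hunion, setIntegral_univ] at h
  refine (funext fun n => ?_ : (fun n : ι → ℤ => _) = fun n => _) ▸ h
  rw [← (measurePreserving_add_right volume (fun i => (n i : ℝ))).setIntegral_preimage_emb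
    (measurableEmbedding_addRight _) G (S n)]
  congr 2
  ext u
  simp [S, hB]

theorem integrable_of_decay (hFc : Continuous F)
    (hF : ∀ u, ‖F u‖ ≤ C * ((1 + ‖u‖) ^ N)⁻¹) (hN : Fintype.card ι < N) : Integrable F := by
  have h := (integrable_one_add_norm (E := ι → ℝ) (μ := volume) (r := N)
    (by simpa using hN)).const_mul C
  refine h.mono' hFc.aestronglyMeasurable (Eventually.of_forall fun u => ?_)
  rw [Real.rpow_neg (by positivity), Real.rpow_natCast]
  exact hF u

/-- **Poisson summation** for a continuous function on `ℝ^ι` which decays at a rate greater than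
the dimension. -/
theorem hasSum_fourier_periodization (hFc : Continuous F)
    (hF : ∀ u, ‖F u‖ ≤ C * ((1 + ‖u‖) ^ N)⁻¹) (hN : Fintype.card ι < N)
    (hsum : Summable fun m : ι → ℤ =>
      ∫ u : ι → ℝ, Complex.exp (-(2 * Real.pi * Complex.I * ∑ i, (m i : ℂ) * u i)) * F u)
    (u : ι → ℝ) :
    HasSum (fun m : ι → ℤ =>
      (∫ u : ι → ℝ, Complex.exp (-(2 * Real.pi * Complex.I * ∑ i, (m i : ℂ) * u i)) * F u) *
        Complex.exp (2 * Real.pi * Complex.I * ∑ i, (m i : ℂ) * u i))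
      (periodization F u) := by
  obtain ⟨f, hf⟩ := exists_continuousMap_unitAddTorus (continuous_periodization hFc hF hN)
    (periodization_add_intCast F)
  -- Unfolding: the character is `ℤ^ι`-periodic, so the coefficient integral over one cube of the
  -- periodization is the integral of `F` over the whole space.
  have hcoeff : UnitAddTorus.mFourierCoeff f = fun m : ι → ℤ =>
      ∫ u : ι → ℝ, Complex.exp (-(2 * Real.pi * Complex.I * ∑ i, (m i : ℂ) * u i)) * F u := by
    funext m
    rw [UnitAddTorus.mFourierCoeff_eq_integral f m 0]
    set e : (ι → ℝ) → ℂ := fun u =>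
      Complex.exp (-(2 * Real.pi * Complex.I * ∑ i, (m i : ℂ) * u i)) with he
    have henorm : ∀ u, ‖e u‖ = 1 := fun u => by
      rw [he]
      dsimp only
      rw [show -(2 * Real.pi * Complex.I * ∑ i, (m i : ℂ) * u i) =
        ((-(2 * Real.pi * ∑ i, (m i : ℝ) * u i) : ℝ) : ℂ) * Complex.I by push_cast; ring]
      exact Complex.norm_exp_ofReal_mul_I _
    have hec : Continuous e := by fun_prop
    have heper : ∀ (u : ι → ℝ) (n : ι → ℤ), e (u + fun i => (n i : ℝ)) = e u := fun u n => by
      have : -(2 * Real.pi * Complex.I * ∑ i, (m i : ℂ) * (((u + fun i => (n i : ℝ)) i : ℝ) : ℂ)) =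
          -(2 * Real.pi * Complex.I * ∑ i, (m i : ℂ) * u i) +
            ((-∑ i, m i * n i : ℤ) : ℂ) * (2 * Real.pi * Complex.I) := by
        simp only [Pi.add_apply]
        push_cast
        simp only [mul_add, Finset.sum_add_distrib]
        ring
      rw [he]
      dsimp only
      rw [this, Complex.exp_add, Complex.exp_int_mul_two_pi_mul_I, mul_one]
    set B : Set (ι → ℝ) := {u : ι → ℝ | ∀ i, u i ∈ Ioc ((0 : ι → ℝ) i) ((0 : ι → ℝ) i + 1)}
      with hB
    have hGint : Integrable fun u => e u * F u :=
      integrable_of_decay (C := C) (N := N) (by fun_prop)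
        (fun u => by rw [norm_mul, henorm, one_mul]; exact hF u) hN
    rw [← (hasSum_setIntegral_intCast_translate hGint).tsum_eq]
    have hBset : B = {u : ι → ℝ | ∀ i, u i ∈ Ioc (0 : ℝ) (0 + 1)} := rfl
    have hBpi : B = Set.pi univ fun _ => Ioc (0 : ℝ) (0 + 1) := by ext u; simp [hBset]
    have hBm : MeasurableSet B := hBpi ▸ MeasurableSet.univ_pi fun _ => measurableSet_Ioc
    have hBvol : volume B = 1 := by
      rw [hBpi, Real.volume_pi_Ioc]
      simp
    rw [← hBset]
    have : IsFiniteMeasure (volume.restrict B) := ⟨by simp [hBvol]⟩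
    have hbound : ∀ n : ι → ℤ, ∀ᵐ v ∂(volume.restrict B),
        ‖e (v + fun i => (n i : ℝ)) * F (v + fun i => (n i : ℝ))‖ ≤
          C * (1 + 1) ^ N * ((1 + ‖fun i => (n i : ℝ)‖) ^ N)⁻¹ := fun n => by
      filter_upwards [ae_restrict_mem hBm] with v hv
      rw [norm_mul, henorm, one_mul]
      refine norm_le_of_decay hF ?_ _
      refine (pi_norm_le_iff_of_nonneg zero_le_one).2 fun i => ?_
      have := hv i
      simp only [Pi.zero_apply, zero_add, mem_Ioc] at this
      rw [Real.norm_eq_abs, abs_le]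
      constructor <;> linarith [this.1, this.2]
    have hsw := hasSum_integral_of_summable_integral_norm (μ := volume.restrict B)
      (F := fun (n : ι → ℤ) v => e (v + fun i => (n i : ℝ)) * F (v + fun i => (n i : ℝ)))
      (fun n => (integrable_const (C * (1 + 1) ^ N * ((1 + ‖fun i => (n i : ℝ)‖) ^ N)⁻¹)).mono'
        (by fun_prop) (hbound n))
      (by
        refine Summable.of_nonneg_of_le (fun n => by positivity) (fun n => ?_)
          ((summable_one_add_norm_intCast_inv_pow hN).mul_left (C * (1 + 1) ^ N))
        refine (integral_mono_of_nonneg (Eventually.of_forall fun v => norm_nonneg _)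
          (integrable_const _) (hbound n)).trans ?_
        simp [measureReal_def, hBvol])
    rw [hsw.tsum_eq]
    refine integral_congr_ae (Eventually.of_forall fun v => ?_)
    dsimp only
    rw [hf, mFourier_apply_coe]
    simp only [heper]
    rw [tsum_mul_left, smul_eq_mul, periodization, he]
    congr 2
    simp
  have h := UnitAddTorus.hasSum_mFourier_series_apply_of_summable (hcoeff ▸ hsum)
    (fun i => (u i : UnitAddCircle))
  rw [hf, hcoeff] at h
  simpa only [mFourier_apply_coe, smul_eq_mul] using h

end Poisson

/-- A sequence of even, continuous, rapidly decaying functions such that the derivative of each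
function is `-r` times the previous one; up to a constant, passing from `g i` to `g (i + 1)` is
integrating the radial function `g i ‖·‖` over planes. -/
structure IsRadialChain (g : ℕ → ℝ → ℂ) : Prop where
  continuous : ∀ i, Continuous (g i)
  even : ∀ i r, g i (-r) = g i r
  hasDerivAt : ∀ i r, HasDerivAt (g (i + 1)) (-(r * g i r)) r
  decay : ∀ i N, ∃ C, ∀ r : ℝ, ‖g i r‖ ≤ C * ((1 + |r|) ^ N)⁻¹

/-! ### Fourier transform of radial functions in odd dimension. -/

namespace IsRadialChain

variable {g : ℕ → ℝ → ℂ}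

theorem apply_abs (hg : IsRadialChain g) (i : ℕ) (r : ℝ) : g i |r| = g i r := by
  rcases abs_choice r with h | h <;> rw [h]
  exact hg.even i r

theorem decay_sqrt (hg : IsRadialChain g) (i M : ℕ) (a : ℝ) :
    ∃ C, ∀ r : ℝ, 0 ≤ r → ‖(r : ℂ) ^ M * g i √(a ^ 2 + r ^ 2)‖ ≤ C * ((1 + r) ^ 2)⁻¹ := by
  -- `M` powers absorb `r ^ M`; the other two give integrability.
  obtain ⟨C, hC⟩ := hg.decay i (M + 2)
  have hC0 : 0 ≤ C := by simpa using (norm_nonneg _).trans (hC 0)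
  refine ⟨C, fun r hr => ?_⟩
  have h1 : r ≤ √(a ^ 2 + r ^ 2) := Real.le_sqrt_of_sq_le (by nlinarith [sq_nonneg a])
  rw [norm_mul, norm_pow, Complex.norm_real, Real.norm_of_nonneg hr]
  calc r ^ M * ‖g i √(a ^ 2 + r ^ 2)‖
      ≤ (1 + r) ^ M * (C * ((1 + r) ^ (M + 2))⁻¹) := by
        refine mul_le_mul (by gcongr; linarith) ((hC _).trans ?_) (norm_nonneg _) (by positivity)
        rw [abs_of_nonneg (Real.sqrt_nonneg _)]
        gcongr
    _ = C * ((1 + r) ^ 2)⁻¹ := by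
        rw [pow_add]
        field_simp

theorem integrableOn_pow_mul_sqrt (hg : IsRadialChain g) (i M : ℕ) (a : ℝ) :
    IntegrableOn (fun r : ℝ => (r : ℂ) ^ M * g i √(a ^ 2 + r ^ 2)) (Ioi 0) := by
  obtain ⟨C, hC⟩ := hg.decay_sqrt i M a
  have h := ((integrable_one_add_norm (E := ℝ) (μ := volume) (r := 2) (by simp)).const_mul
    C).integrableOn (s := Ioi 0)
  have := hg.continuous i
  refine h.mono' (by fun_prop) ((ae_restrict_mem measurableSet_Ioi).mono fun r hr => ?_)
  rw [Real.norm_of_nonneg (le_of_lt hr), Real.rpow_neg (by positivity [mem_Ioi.1 hr])]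
  exact_mod_cast hC r (le_of_lt hr)

/-- The factor `r / √(a² + r²)` from the chain rule cancels the `√(a² + r²)` of the chain relation,
so the relation persists on every slice. -/
theorem hasDerivAt_sqrt (hg : IsRadialChain g) (i : ℕ) (a : ℝ) {r : ℝ} (hr : 0 < r) :
    HasDerivAt (fun r : ℝ => g (i + 1) √(a ^ 2 + r ^ 2)) (-(r * g i √(a ^ 2 + r ^ 2))) r := by
  have hpos : 0 < a ^ 2 + r ^ 2 := by positivity
  have h1 : HasDerivAt (fun r : ℝ => √(a ^ 2 + r ^ 2)) (r / √(a ^ 2 + r ^ 2)) r := by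
    have h2 := (((hasDerivAt_id r).pow 2).const_add (a ^ 2)).sqrt hpos.ne'
    refine h2.congr_deriv ?_
    simp
    field_simp
  refine ((hg.hasDerivAt i _).scomp r h1).congr_deriv ?_
  have : (√(a ^ 2 + r ^ 2) : ℂ) ≠ 0 := by exact_mod_cast (Real.sqrt_pos.2 hpos).ne'
  rw [Complex.real_smul]
  push_cast
  field_simp

theorem tendsto_pow_mul_sqrt (hg : IsRadialChain g) (i M : ℕ) (a : ℝ) :
    Tendsto (fun r : ℝ => (r : ℂ) ^ M * g i √(a ^ 2 + r ^ 2)) atTop (𝓝 0) := by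
  obtain ⟨C, hC⟩ := hg.decay_sqrt i M a
  refine squeeze_zero_norm' ((eventually_ge_atTop 0).mono fun r hr => hC r hr) ?_
  have : Tendsto (fun r : ℝ => ((1 + r) ^ 2)⁻¹) atTop (𝓝 0) :=
    tendsto_inv_atTop_zero.comp ((tendsto_pow_atTop two_ne_zero).comp
      (tendsto_atTop_add_const_left _ _ tendsto_id))
  simpa using this.const_mul C

theorem integral_mul_sqrt (hg : IsRadialChain g) (i : ℕ) (a : ℝ) :
    ∫ r in Ioi (0 : ℝ), (r : ℂ) ^ 1 * g i √(a ^ 2 + r ^ 2) = g (i + 1) a := by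
  have hc := hg.continuous (i + 1)
  have h := integral_Ioi_of_hasDerivAt_of_tendsto (a := 0)
    (f := fun r : ℝ => g (i + 1) √(a ^ 2 + r ^ 2))
    (f' := fun r : ℝ => -((r : ℂ) ^ 1 * g i √(a ^ 2 + r ^ 2))) (m := 0)
    (by fun_prop) (fun r hr => by simpa using hg.hasDerivAt_sqrt i a hr)
    (hg.integrableOn_pow_mul_sqrt i 1 a).neg (by simpa using hg.tendsto_pow_mul_sqrt (i + 1) 0 a)
  rw [integral_neg, zero_sub, neg_inj] at h
  rw [h]
  simp [Real.sqrt_sq_eq_abs, hg.apply_abs]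

/-- Integration by parts: two powers of `r` are traded for one step up the chain. -/
theorem integral_pow_mul_sqrt_succ (hg : IsRadialChain g) (i m : ℕ) (a : ℝ) :
    ∫ r in Ioi (0 : ℝ), (r : ℂ) ^ (2 * (m + 1) + 1) * g i √(a ^ 2 + r ^ 2) =
      2 * (m + 1) * ∫ r in Ioi (0 : ℝ), (r : ℂ) ^ (2 * m + 1) * g (i + 1) √(a ^ 2 + r ^ 2) := by
  have hc := hg.continuous (i + 1)
  have hi := (hg.integrableOn_pow_mul_sqrt (i + 1) (2 * m + 1) a).const_mul (2 * ((m : ℂ) + 1))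
  have hi' := hg.integrableOn_pow_mul_sqrt i (2 * (m + 1) + 1) a
  have h := integral_Ioi_of_hasDerivAt_of_tendsto (a := 0)
    (f := fun r : ℝ => (r : ℂ) ^ (2 * (m + 1)) * g (i + 1) √(a ^ 2 + r ^ 2))
    (f' := fun r : ℝ => 2 * ((m : ℂ) + 1) * ((r : ℂ) ^ (2 * m + 1) * g (i + 1) √(a ^ 2 + r ^ 2)) -
      ((r : ℂ) ^ (2 * (m + 1) + 1) * g i √(a ^ 2 + r ^ 2))) (m := 0)
    (by fun_prop) (fun r hr => ?_) (hi.sub hi') (hg.tendsto_pow_mul_sqrt (i + 1) _ a)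
  · rw [integral_sub hi hi', integral_const_mul] at h
    rw [← sub_eq_zero, ← neg_sub, h]
    simp
  · have hp : HasDerivAt (fun r : ℝ => (r : ℂ) ^ (2 * (m + 1)))
        (((2 * (m + 1) : ℕ) : ℂ) * (r : ℂ) ^ (2 * m + 1)) r := by
      refine ((Complex.ofRealCLM.hasDerivAt (x := r)).pow (2 * (m + 1))).congr_deriv ?_
      rw [show 2 * (m + 1) - 1 = 2 * m + 1 by omega]
      simp
    refine (hp.mul (hg.hasDerivAt_sqrt i a hr)).congr_deriv ?_
    push_cast
    ring

theorem integral_pow_mul_sqrt (hg : IsRadialChain g) (m i : ℕ) (a : ℝ) :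
    ∫ r in Ioi (0 : ℝ), (r : ℂ) ^ (2 * m + 1) * g i √(a ^ 2 + r ^ 2) =
      2 ^ m * (m.factorial : ℂ) * g (i + m + 1) a := by
  induction m generalizing i with
  | zero => simpa using hg.integral_mul_sqrt i a
  | succ m ih =>
    rw [hg.integral_pow_mul_sqrt_succ, ih, Nat.factorial_succ, show i + 1 + m = i + (m + 1) by ring]
    push_cast
    ring

/-- In polar coordinates the weight `r^{2j-1}` is odd. The constant is `2j · (π^j / j!) · 2^{j-1}
(j-1)! = (2π)^j`. -/
theorem integral_euclidean_sqrt (hg : IsRadialChain g) {j : ℕ} (hj : 0 < j) (a : ℝ) :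
    ∫ u : EuclideanSpace ℝ (Fin (2 * j)), g 0 √(a ^ 2 + ‖u‖ ^ 2) =
      (2 * Real.pi) ^ j * g j a := by
  obtain ⟨m, rfl⟩ := Nat.exists_eq_succ_of_ne_zero hj.ne'
  have : Nontrivial (EuclideanSpace ℝ (Fin (2 * m.succ))) :=
    Module.nontrivial_of_finrank_pos (R := ℝ) (by simp)
  rw [integral_fun_norm_addHaar volume fun r => g 0 √(a ^ 2 + r ^ 2)]
  have h1 := hg.integral_pow_mul_sqrt m 0 a
  have h2 : ∫ r in Ioi (0 : ℝ), r ^ (Module.finrank ℝ (EuclideanSpace ℝ (Fin (2 * m.succ))) - 1) •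
      g 0 √(a ^ 2 + r ^ 2) = 2 ^ m * (m.factorial : ℂ) * g (m + 1) a := by
    rw [Nat.zero_add] at h1
    rw [← h1]
    refine setIntegral_congr_fun measurableSet_Ioi fun r _ => ?_
    simp [Nat.mul_succ]
  rw [h2, measureReal_def, EuclideanSpace.volume_ball]
  have h3 : √Real.pi ^ (2 * m.succ) = Real.pi ^ m.succ := by
    rw [pow_mul, Real.sq_sqrt Real.pi_nonneg]
  have h4 : Real.Gamma (((2 * m.succ : ℕ) : ℝ) / 2 + 1) = m.succ.factorial := by
    rw [← Real.Gamma_nat_eq_factorial]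
    push_cast
    congr 1
    ring
  simp only [Fintype.card_fin, finrank_euclideanSpace, h3, h4, ENNReal.ofReal_one, one_pow, one_mul]
  rw [ENNReal.toReal_ofReal (by positivity), nsmul_eq_mul, Complex.real_smul, Nat.factorial_succ]
  have : (m.factorial : ℂ) ≠ 0 := by exact_mod_cast m.factorial_ne_zero
  have : (m + 1 : ℂ) ≠ 0 := by exact_mod_cast m.succ_ne_zero
  push_cast
  field_simp
  simp only [Nat.succ_eq_add_one, mul_pow]
  ring

theorem exists_decay_norm (hg : IsRadialChain g) {E : Type*} [SeminormedAddCommGroup E] (i N : ℕ) :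
    ∃ C, ∀ v : E, ‖g i ‖v‖‖ ≤ C * ((1 + ‖v‖) ^ N)⁻¹ := by
  obtain ⟨C, hC⟩ := hg.decay i N
  exact ⟨C, fun v => by simpa using hC ‖v‖⟩

theorem integrable_norm (hg : IsRadialChain g) {E : Type*} [NormedAddCommGroup E]
    [NormedSpace ℝ E] [FiniteDimensional ℝ E] [MeasurableSpace E] [BorelSpace E]
    (μ : Measure E) [μ.IsAddHaarMeasure] (i : ℕ) : Integrable (fun v : E => g i ‖v‖) μ := by
  obtain ⟨C, hC⟩ := hg.exists_decay_norm (E := E) i (Module.finrank ℝ E + 1)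
  have := hg.continuous i
  have h := (integrable_one_add_norm (E := E) (μ := μ)
    (r := (Module.finrank ℝ E + 1 : ℕ)) (by push_cast; linarith)).const_mul C
  refine h.mono' (by fun_prop) (Eventually.of_forall fun u => ?_)
  rw [Real.rpow_neg (by positivity), Real.rpow_natCast]
  exact hC u

/-- The Fourier transform of a radial function in odd dimension `2 j + 1`. -/
theorem integral_euclidean_fourier (hg : IsRadialChain g) {j : ℕ} (hj : 0 < j)
    (η : EuclideanSpace ℝ (Fin (2 * j + 1))) :
    ∫ v : EuclideanSpace ℝ (Fin (2 * j + 1)),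
        Complex.exp (-(2 * Real.pi * Complex.I * (inner ℝ η v : ℝ))) * g 0 ‖v‖ =
      (2 * Real.pi) ^ j * 𝓕 (g j) ‖η‖ := by
  set e₀ : EuclideanSpace ℝ (Fin (2 * j + 1)) := EuclideanSpace.single 0 ‖η‖ with he₀
  have hnorm : ‖η‖ = ‖e₀‖ := by simp [he₀]
  -- This reflection carries `η` to `‖η‖` times the first basis vector and preserves `‖v‖`.
  let R := (Submodule.span ℝ {η - e₀})ᗮ.reflection
  have hR : R η = e₀ := Submodule.reflection_sub hnorm
  have h1 : ∫ v : EuclideanSpace ℝ (Fin (2 * j + 1)),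
        Complex.exp (-(2 * Real.pi * Complex.I * (inner ℝ η v : ℝ))) * g 0 ‖v‖ =
      ∫ v : EuclideanSpace ℝ (Fin (2 * j + 1)),
        Complex.exp (-(2 * Real.pi * Complex.I * (‖η‖ * v 0 : ℝ))) * g 0 ‖v‖ := by
    rw [← R.measurePreserving.integral_comp R.toHomeomorph.measurableEmbedding
      fun v => Complex.exp (-(2 * Real.pi * Complex.I * (‖η‖ * v 0 : ℝ))) * g 0 ‖v‖]
    refine integral_congr_ae (Eventually.of_forall fun v => ?_)
    dsimp only
    rw [R.norm_map, ← R.inner_map_map, hR, he₀, EuclideanSpace.inner_single_left]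
    simp
  let Φ : ℝ × EuclideanSpace ℝ (Fin (2 * j)) → ℂ := fun p =>
    Complex.exp (-(2 * Real.pi * Complex.I * (‖η‖ * p.1 : ℝ))) * g 0 √(p.1 ^ 2 + ‖p.2‖ ^ 2)
  let T : EuclideanSpace ℝ (Fin (2 * j + 1)) ≃ᵐ ℝ × EuclideanSpace ℝ (Fin (2 * j)) :=
    ((MeasurableEquiv.toLp 2 (Fin (2 * j + 1) → ℝ)).symm.trans
      (MeasurableEquiv.piFinSuccAbove (fun _ => ℝ) 0)).trans
        ((MeasurableEquiv.refl ℝ).prodCongr (MeasurableEquiv.toLp 2 (Fin (2 * j) → ℝ)))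
  have hT : MeasurePreserving T volume (volume.prod volume) :=
    (((MeasurePreserving.id volume).prod (PiLp.volume_preserving_toLp (Fin (2 * j)))).comp
      (volume_preserving_piFinSuccAbove (fun _ => ℝ) 0)).comp
        (PiLp.volume_preserving_ofLp (Fin (2 * j + 1)))
  have hΦT : ∀ v, Φ (T v) =
      Complex.exp (-(2 * Real.pi * Complex.I * (‖η‖ * v 0 : ℝ))) * g 0 ‖v‖ := fun v => by
    have hn : ‖v‖ = √((T v).1 ^ 2 + ‖(T v).2‖ ^ 2) := by
      rw [EuclideanSpace.norm_eq, EuclideanSpace.norm_sq_eq, Fin.sum_univ_succ]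
      simp [T]
      rfl
    simp only [Φ]
    rw [← hn]
    rfl
  have hint : Integrable Φ (volume.prod volume) := by
    rw [← hT.integrable_comp_emb T.measurableEmbedding]
    refine (hg.integrable_norm volume 0).norm.mono' ?_ (Eventually.of_forall fun v => ?_)
    · have := hg.continuous 0
      refine Continuous.aestronglyMeasurable ?_
      rw [show Φ ∘ T = _ from funext hΦT]
      fun_prop
    · rw [Function.comp_apply, hΦT, norm_mul]
      refine (mul_le_of_le_one_left (norm_nonneg _) (le_of_eq ?_))
      rw [show -(2 * Real.pi * Complex.I * (‖η‖ * v 0 : ℝ)) =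
        ((-(2 * Real.pi * (‖η‖ * v 0)) : ℝ) : ℂ) * Complex.I by push_cast; ring]
      exact Complex.norm_exp_ofReal_mul_I _
  rw [h1]
  simp only [← hΦT]
  -- Fubini: the phase depends only on the first coordinate `t`, and the integral over the
  -- hyperplane at height `t` is `(2π)^j g j t`.
  rw [hT.integral_comp T.measurableEmbedding Φ, integral_prod _ hint]
  simp only [Φ, integral_const_mul, hg.integral_euclidean_sqrt hj]
  rw [Real.fourier_real_eq_integral_exp_smul, ← integral_const_mul]
  refine integral_congr_ae (Eventually.of_forall fun t => ?_)
  dsimp only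
  rw [smul_eq_mul, mul_left_comm]
  congr 3
  push_cast
  ring

end IsRadialChain

/-! ### Schwartz antiderivatives of odd functions. -/

section Antiderivative

theorem _root_.SchwartzMap.exists_norm_le_inv_one_add_pow (h : 𝓢(ℝ, ℂ)) (N : ℕ) :
    ∃ C, ∀ r : ℝ, ‖h r‖ ≤ C * ((1 + |r|) ^ N)⁻¹ := by
  refine ⟨2 ^ N * (Finset.Iic (N, 0)).sup (fun m => SchwartzMap.seminorm ℂ m.1 m.2) h,
    fun r => ?_⟩
  rw [← div_eq_mul_inv, le_div_iff₀ (by positivity), mul_comm]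
  simpa using SchwartzMap.one_add_le_sup_seminorm_apply (𝕜 := ℂ) (m := (N, 0)) le_rfl le_rfl h r

/-- An odd Schwartz function has an even Schwartz antiderivative. -/
theorem exists_even_schwartz_antideriv (h : 𝓢(ℝ, ℂ)) (hodd : ∀ r, h (-r) = -h r) :
    ∃ H : 𝓢(ℝ, ℂ), (∀ r, H (-r) = H r) ∧ ∀ r, HasDerivAt H (-h r) r := by
  -- The constant makes `H r` the tail integral over `(r, ∞)`, which decays at `+∞`; evenness
  -- transfers the decay to `-∞`.
  let H : ℝ → ℂ := fun r => (∫ s in Ioi 0, h s) - ∫ s in (0 : ℝ)..r, h s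
  have hder : ∀ r, HasDerivAt H (-h r) r := fun r => by
    simpa using (intervalIntegral.integral_hasDerivAt_right (h.continuous.intervalIntegrable 0 r)
      h.continuous.stronglyMeasurable.stronglyMeasurableAtFilter
      h.continuous.continuousAt).const_sub (∫ s in Ioi 0, h s)
  have hderiv : deriv H = fun r => -h r := funext fun r => (hder r).deriv
  have heven : ∀ r, H (-r) = H r := fun r => by
    have := intervalIntegral.integral_comp_neg (a := 0) (b := r) fun s => h s
    simp only [hodd, intervalIntegral.integral_neg, neg_zero] at this
    simp only [H]
    rw [intervalIntegral.integral_symm, ← this, neg_neg]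
  have htail : ∀ r, H r = ∫ s in Ioi r, h s := fun r => by
    simp only [H]
    rw [← intervalIntegral.integral_interval_add_Ioi h.integrable.integrableOn
      h.integrable.integrableOn (b := r), add_sub_cancel_left]
  have hdecay : ∀ k : ℕ, ∃ C, ∀ r, ‖r‖ ^ k * ‖H r‖ ≤ C := fun k => by
    have hint := h.integrable_pow_mul volume k
    have hpos : ∀ r : ℝ, 0 ≤ r → ‖r‖ ^ k * ‖H r‖ ≤ ∫ s : ℝ, ‖s‖ ^ k * ‖h s‖ := fun r hr => by
      rw [htail]
      calc ‖r‖ ^ k * ‖∫ s in Ioi r, h s‖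
          ≤ ‖r‖ ^ k * ∫ s in Ioi r, ‖h s‖ := by
            gcongr
            exact norm_integral_le_integral_norm _
        _ = ∫ s in Ioi r, ‖r‖ ^ k * ‖h s‖ := (integral_const_mul _ _).symm
        _ ≤ ∫ s in Ioi r, ‖s‖ ^ k * ‖h s‖ := by
            refine setIntegral_mono_on (h.integrable.norm.const_mul _).integrableOn
              hint.integrableOn measurableSet_Ioi fun s hs => ?_
            have hs' : r < s := hs
            gcongr
            rw [Real.norm_of_nonneg hr, Real.norm_of_nonneg (hr.trans hs'.le)]
            exact hs'.le
        _ ≤ ∫ s : ℝ, ‖s‖ ^ k * ‖h s‖ :=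
            setIntegral_le_integral hint (Eventually.of_forall fun s => by positivity)
    refine ⟨∫ s : ℝ, ‖s‖ ^ k * ‖h s‖, fun r => ?_⟩
    rcases le_total 0 r with hr | hr
    · exact hpos r hr
    · rw [← norm_neg r, ← heven r]
      exact hpos (-r) (neg_nonneg.2 hr)
  have hsmooth : ContDiff ℝ ∞ H := by
    rw [contDiff_infty_iff_deriv]
    refine ⟨fun r => (hder r).differentiableAt, ?_⟩
    rw [hderiv]
    exact (h.smooth ⊤).neg
  refine ⟨⟨H, hsmooth, fun k n => ?_⟩, heven, hder⟩
  cases n with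
  | zero => simpa using hdecay k
  | succ n =>
    obtain ⟨C, hC⟩ := (-h).decay k n
    refine ⟨C, fun r => ?_⟩
    rw [norm_iteratedFDeriv_eq_norm_iteratedDeriv, iteratedDeriv_succ', hderiv,
      ← norm_iteratedFDeriv_eq_norm_iteratedDeriv]
    exact hC.2 r

end Antiderivative

/-! ### The chain above the odd part of `𝓕 φ`, and its Fourier transforms. -/

section Chain

theorem hasTemperateGrowth_ofReal : Function.HasTemperateGrowth (fun r : ℝ => (r : ℂ)) :=
  Complex.ofRealCLM.hasTemperateGrowth

/-- Every odd Schwartz function starts a sequence of even Schwartz functions each of which has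
derivative `-r` times the previous one. -/
theorem exists_schwartz_chain (h : 𝓢(ℝ, ℂ)) (hodd : ∀ r, h (-r) = -h r) :
    ∃ G : ℕ → 𝓢(ℝ, ℂ), (∀ i r, G i (-r) = G i r) ∧ (∀ r, HasDerivAt (G 0) (-h r) r) ∧
      ∀ i r, HasDerivAt (G (i + 1)) (-(r * G i r)) r := by
  obtain ⟨G₀, hG₀, hG₀'⟩ := exists_even_schwartz_antideriv h hodd
  have hstep : ∀ g : {g : 𝓢(ℝ, ℂ) // ∀ r, g (-r) = g r}, ∃ g' : {g : 𝓢(ℝ, ℂ) // ∀ r, g (-r) = g r},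
      ∀ r, HasDerivAt g'.1 (-(r * g.1 r)) r := fun g => by
    obtain ⟨H, hH, hH'⟩ := exists_even_schwartz_antideriv
      (SchwartzMap.smulLeftCLM ℂ (fun r : ℝ => (r : ℂ)) g.1) fun r => by
        simp [SchwartzMap.smulLeftCLM_apply_apply hasTemperateGrowth_ofReal, g.2 r]
    refine ⟨⟨H, hH⟩, fun r => ?_⟩
    simpa [SchwartzMap.smulLeftCLM_apply_apply hasTemperateGrowth_ofReal] using hH' r
  choose s hs using hstep
  let G : ℕ → {g : 𝓢(ℝ, ℂ) // ∀ r, g (-r) = g r} := fun i => s^[i] ⟨G₀, hG₀⟩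
  refine ⟨fun i => (G i).1, fun i => (G i).2, hG₀', fun i r => ?_⟩
  have : G (i + 1) = s (G i) := Function.iterate_succ_apply' s i _
  dsimp only
  rw [this]
  exact hs (G i) r

variable {h : 𝓢(ℝ, ℂ)} {G : ℕ → 𝓢(ℝ, ℂ)}

theorem mul_dslope_zero (hodd : ∀ r, h (-r) = -h r) (r : ℝ) : (r : ℂ) * dslope h 0 r = h r := by
  have h0 : h 0 = 0 := by
    have := hodd 0
    rw [neg_zero] at this
    exact self_eq_neg.1 this
  have := sub_smul_dslope h 0 r
  simpa [h0] using this

/-- The bottom link `h(r)/r`, realised as `dslope h 0`, need only be continuous and decaying; the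
Schwartz functions `G i` sit one index higher. -/
theorem isRadialChain_of_schwartz (hodd : ∀ r, h (-r) = -h r) (heven : ∀ i r, G i (-r) = G i r)
    (h0 : ∀ r, HasDerivAt (G 0) (-h r) r)
    (hsucc : ∀ i r, HasDerivAt (G (i + 1)) (-(r * G i r)) r) :
    IsRadialChain fun i => Nat.casesOn i (dslope h 0) fun i => G i := by
  have hne : ∀ r : ℝ, r ≠ 0 → dslope h 0 r = (r : ℂ)⁻¹ * h r := fun r hr => by
    have : (r : ℂ) ≠ 0 := by exact_mod_cast hr
    rw [← mul_dslope_zero hodd, inv_mul_cancel_left₀ this]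
  have hcont : Continuous (dslope h 0) := continuous_iff_continuousAt.2 fun r => by
    rcases eq_or_ne r 0 with rfl | hr
    · exact continuousAt_dslope_same.2 h.differentiableAt
    · exact (continuousAt_dslope_of_ne hr).2 h.continuous.continuousAt
  refine ⟨fun i => ?_, fun i r => ?_, fun i r => ?_, fun i N => ?_⟩
  · cases i with
    | zero => exact hcont
    | succ i => exact (G i).continuous
  · cases i with
    | zero =>
      rcases eq_or_ne r 0 with rfl | hr
      · simp
      · change dslope h 0 (-r) = dslope h 0 r
        rw [hne r hr, hne (-r) (neg_ne_zero.2 hr), hodd]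
        push_cast
        rw [inv_neg, neg_mul_neg]
    | succ i => exact heven i r
  · cases i with
    | zero =>
      exact (h0 r).congr_deriv (congrArg Neg.neg (mul_dslope_zero hodd r).symm)
    | succ i => exact hsucc i r
  · cases i with
    | zero =>
      obtain ⟨C, hC⟩ := h.exists_norm_le_inv_one_add_pow N
      obtain ⟨K, hK⟩ := (isCompact_Icc (a := (-1 : ℝ)) (b := 1)).exists_bound_of_continuousOn
        hcont.continuousOn
      have hC0 : 0 ≤ C := by simpa using (norm_nonneg _).trans (hC 0)
      have hK0 : 0 ≤ K := (norm_nonneg _).trans (hK 0 (by simp))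
      refine ⟨max C (K * 2 ^ N), fun r => ?_⟩
      rcases le_total |r| 1 with hr | hr
      · refine (hK r (abs_le.1 hr)).trans ?_
        rw [← div_eq_mul_inv, le_div_iff₀ (by positivity)]
        refine le_trans ?_ (le_max_right _ _)
        gcongr
        linarith
      · have hr0 : r ≠ 0 := fun h => by norm_num [h] at hr
        change ‖dslope h 0 r‖ ≤ _
        rw [hne r hr0, norm_mul, norm_inv, Complex.norm_real, Real.norm_eq_abs]
        calc |r|⁻¹ * ‖h r‖ ≤ 1 * ‖h r‖ := by gcongr; exact inv_le_one_of_one_le₀ hr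
          _ ≤ C * ((1 + |r|) ^ N)⁻¹ := by rw [one_mul]; exact hC r
          _ ≤ _ := by gcongr; exact le_max_left _ _
    | succ i => exact (G i).exists_norm_le_inv_one_add_pow N

theorem fourier_schwartz_deriv {g g' : 𝓢(ℝ, ℂ)} (hg : ∀ r, HasDerivAt g (g' r) r) (ρ : ℝ) :
    (𝓕 g' : 𝓢(ℝ, ℂ)) ρ = 2 * Real.pi * Complex.I * ρ * (𝓕 g : 𝓢(ℝ, ℂ)) ρ := by
  have hd : deriv g = g' := funext fun r => (hg r).deriv
  have := Real.fourier_deriv g.integrable g.differentiable (hd ▸ g'.integrable)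
  rw [SchwartzMap.fourier_coe, SchwartzMap.fourier_coe, ← hd, this]
  simp

/-- Differentiating the transform multiplies by `-2πir`, and `-r G i` is the derivative of `G (i +
1)`, whose transform carries the factor `2πiρ`. -/
theorem hasDerivAt_fourier_chain (hsucc : ∀ i r, HasDerivAt (G (i + 1)) (-(r * G i r)) r)
    (i : ℕ) (ρ : ℝ) :
    HasDerivAt (𝓕 (G i) : 𝓢(ℝ, ℂ))
      (-(4 * Real.pi ^ 2 * ρ * (𝓕 (G (i + 1)) : 𝓢(ℝ, ℂ)) ρ)) ρ := by
  have hint : Integrable fun r : ℝ => r • G i r := by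
    refine ((G i).integrable_pow_mul volume 1).mono' ?_ (Eventually.of_forall fun r => ?_)
    · exact (continuous_id.smul (G i).continuous).aestronglyMeasurable
    · rw [norm_smul, pow_one]
  have h1 := Real.hasDerivAt_fourier (G i).integrable hint ρ
  have h2 := fourier_schwartz_deriv (g := G (i + 1))
    (g' := -SchwartzMap.smulLeftCLM ℂ (fun r : ℝ => (r : ℂ)) (G i))
    (fun r => by
      simpa [SchwartzMap.smulLeftCLM_apply_apply hasTemperateGrowth_ofReal] using hsucc i r) ρ
  rw [SchwartzMap.fourier_coe (G i)]
  refine h1.congr_deriv ?_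
  have h3 : (fun r : ℝ => (-2 * Real.pi * Complex.I * r) • G i r) =
      ⇑((2 * Real.pi * Complex.I) •
        -SchwartzMap.smulLeftCLM ℂ (fun r : ℝ => (r : ℂ)) (G i)) := by
    ext r
    simp [SchwartzMap.smulLeftCLM_apply_apply hasTemperateGrowth_ofReal]
    ring
  rw [h3, ← SchwartzMap.fourier_coe, FourierTransform.fourier_smul, smul_apply, h2]
  rw [smul_eq_mul]
  linear_combination (4 * Real.pi ^ 2 * ρ * (𝓕 (G (i + 1)) : 𝓢(ℝ, ℂ)) ρ) * Complex.I_sq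

/-- Twice the imaginary odd part of the Fourier transform. -/
noncomputable def fourierOddPart (φ : 𝓢(ℝ, ℂ)) : 𝓢(ℝ, ℂ) := 𝓕 φ - 𝓕⁻ φ

theorem fourierInv_apply_eq_neg (φ : 𝓢(ℝ, ℂ)) (r : ℝ) : 𝓕⁻ φ r = 𝓕 φ (-r) := by
  rw [SchwartzMap.fourierInv_coe, SchwartzMap.fourier_coe, Real.fourierInv_eq_fourier_neg]

theorem fourierOddPart_apply (φ : 𝓢(ℝ, ℂ)) (r : ℝ) :
    fourierOddPart φ r = 𝓕 φ r - 𝓕 φ (-r) := by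
  rw [fourierOddPart, sub_apply, fourierInv_apply_eq_neg]

theorem fourierOddPart_neg (φ : 𝓢(ℝ, ℂ)) (r : ℝ) :
    fourierOddPart φ (-r) = -fourierOddPart φ r := by
  simp [fourierOddPart_apply]

theorem fourier_fourierOddPart (φ : 𝓢(ℝ, ℂ)) (ρ : ℝ) :
    𝓕 (fourierOddPart φ) ρ = φ (-ρ) - φ ρ := by
  rw [fourierOddPart, sub_eq_add_neg, FourierTransform.fourier_add, FourierTransform.fourier_neg,
    FourierTransform.fourier_fourierInv_eq]
  have : (𝓕 (𝓕 φ) : 𝓢(ℝ, ℂ)) ρ = φ (-ρ) := by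
    have h := fourierInv_apply_eq_neg (𝓕 φ) (-ρ)
    rw [neg_neg, FourierTransform.fourierInv_fourier_eq] at h
    exact h.symm
  rw [add_apply, this, neg_apply, sub_eq_add_neg]

end Chain

/-! ### Jets of `φ(τ)/(τ + a)^p` on the diagonal `τ = a`. -/

/-- The `k`-th derivative of `τ ↦ φ τ / (τ + a) ^ p` at `τ = a`, as a recursively defined
expression. -/
noncomputable def quotientJet : ℕ → ℕ → 𝓢(ℝ, ℂ) → ℝ → ℂ
  | 0, p, φ, a => φ a * ((2 * a : ℂ) ^ p)⁻¹
  | k + 1, p, φ, a =>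
    quotientJet k p (SchwartzMap.derivCLM ℂ ℂ φ) a - p * quotientJet k (p + 1) φ a

theorem contDiffAt_mul_inv_pow (φ : 𝓢(ℝ, ℂ)) (p : ℕ) (n : ℕ∞) {a τ : ℝ} (h : τ + a ≠ 0) :
    ContDiffAt ℝ n (fun τ : ℝ => φ τ * (((τ : ℂ) + a) ^ p)⁻¹) τ := by
  have hne : ((τ : ℂ) + a) ^ p ≠ 0 := pow_ne_zero _ (by exact_mod_cast h)
  have h1 : ContDiff ℝ n fun τ : ℝ => ((τ : ℂ) + a) ^ p :=
    ((Complex.ofRealCLM.contDiff (n := n)).add contDiff_const).pow p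
  exact (φ.contDiffAt n).mul (h1.contDiffAt.inv hne)

theorem hasDerivAt_mul_inv_pow (φ : 𝓢(ℝ, ℂ)) (p : ℕ) {a τ : ℝ} (h : τ + a ≠ 0) :
    HasDerivAt (fun τ : ℝ => φ τ * (((τ : ℂ) + a) ^ p)⁻¹)
      (SchwartzMap.derivCLM ℂ ℂ φ τ * (((τ : ℂ) + a) ^ p)⁻¹ -
        p * (φ τ * (((τ : ℂ) + a) ^ (p + 1))⁻¹)) τ := by
  have hne : (τ : ℂ) + a ≠ 0 := by exact_mod_cast h
  have h1 : HasDerivAt (fun τ : ℝ => (τ : ℂ) + a) 1 τ :=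
    (Complex.ofRealCLM.hasDerivAt (x := τ)).add_const (a : ℂ)
  refine ((φ.hasDerivAt τ).mul ((h1.pow p).inv (pow_ne_zero p hne))).congr_deriv ?_
  simp only [SchwartzMap.derivCLM_apply, Pi.inv_apply, Pi.pow_apply]
  rcases p with _ | p
  · simp
  · push_cast
    field_simp
    ring

theorem iteratedDeriv_mul_inv_pow (k : ℕ) (p : ℕ) (φ : 𝓢(ℝ, ℂ)) {a : ℝ} (ha : a ≠ 0) :
    iteratedDeriv k (fun τ : ℝ => φ τ * (((τ : ℂ) + a) ^ p)⁻¹) a = quotientJet k p φ a := by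
  induction k generalizing p φ with
  | zero =>
    simp only [iteratedDeriv_zero, quotientJet]
    rw [two_mul]
  | succ k ih =>
    have ha' : a + a ≠ 0 := fun h => ha (by linarith)
    have hev : ∀ᶠ τ in 𝓝 a, τ + a ≠ 0 :=
      (continuous_id.add continuous_const).continuousAt.eventually_ne ha'
    have hd : deriv (fun τ : ℝ => φ τ * (((τ : ℂ) + a) ^ p)⁻¹) =ᶠ[𝓝 a]
        (fun τ : ℝ => SchwartzMap.derivCLM ℂ ℂ φ τ * (((τ : ℂ) + a) ^ p)⁻¹) -
          fun τ : ℝ => (p : ℂ) * (φ τ * (((τ : ℂ) + a) ^ (p + 1))⁻¹) :=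
      hev.mono fun τ hτ => (hasDerivAt_mul_inv_pow φ p hτ).deriv
    rw [iteratedDeriv_succ', hd.iteratedDeriv_eq, iteratedDeriv_sub
      (contDiffAt_mul_inv_pow _ p k ha')
      (contDiffAt_const.mul (contDiffAt_mul_inv_pow φ (p + 1) k ha')), ih,
      iteratedDeriv_const_mul_field, ih, quotientJet]

theorem derivDeltaMul_eq_quotientJet (k p : ℕ) (φ : 𝓢(ℝ, ℂ)) {a : ℝ} (ha : a ≠ 0) :
    derivDeltaMul k a (fun τ => (((τ + a) ^ p : ℝ) : ℂ)⁻¹) φ = (-1) ^ k * quotientJet k p φ a := by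
  rw [derivDeltaMul, ← iteratedDeriv_mul_inv_pow k p φ ha]
  congr 2
  funext τ
  push_cast
  ring

/-- Leibniz rule for `φ/(τ+a)^p = (τ+a) · φ/(τ+a)^{p+1}`: the linear factor has value `2a` and
derivative `1`. -/
theorem quotientJet_eq_add (k p : ℕ) (φ : 𝓢(ℝ, ℂ)) {a : ℝ} (ha : a ≠ 0) :
    quotientJet (k + 1) p φ a =
      2 * a * quotientJet (k + 1) (p + 1) φ a + (k + 1) * quotientJet k (p + 1) φ a := by
  have ha' : (a : ℂ) ≠ 0 := by exact_mod_cast ha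
  have h0 : ∀ (p : ℕ) (φ : 𝓢(ℝ, ℂ)),
      quotientJet 0 p φ a = 2 * a * quotientJet 0 (p + 1) φ a := fun p φ => by
    simp only [quotientJet]
    field_simp
    ring
  induction k generalizing p φ with
  | zero =>
    have h1 := h0 p (SchwartzMap.derivCLM ℂ ℂ φ)
    have h2 := h0 (p + 1) φ
    rw [show quotientJet (0 + 1) p φ a =
      quotientJet 0 p (SchwartzMap.derivCLM ℂ ℂ φ) a - (p : ℂ) * quotientJet 0 (p + 1) φ a from rfl,
      show quotientJet (0 + 1) (p + 1) φ a =
      quotientJet 0 (p + 1) (SchwartzMap.derivCLM ℂ ℂ φ) a -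
        ((p + 1 : ℕ) : ℂ) * quotientJet 0 (p + 1 + 1) φ a from rfl]
    push_cast
    linear_combination h1 - p * h2 - h2
  | succ k ih =>
    have h1 := ih p (SchwartzMap.derivCLM ℂ ℂ φ)
    have h2 := ih (p + 1) φ
    have h3 : quotientJet (k + 1) (p + 1) φ a =
      quotientJet k (p + 1) (SchwartzMap.derivCLM ℂ ℂ φ) a -
        ((p + 1 : ℕ) : ℂ) * quotientJet k (p + 1 + 1) φ a := rfl
    rw [show quotientJet (k + 1 + 1) p φ a =
      quotientJet (k + 1) p (SchwartzMap.derivCLM ℂ ℂ φ) a -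
        (p : ℂ) * quotientJet (k + 1) (p + 1) φ a from rfl,
      show quotientJet (k + 1 + 1) (p + 1) φ a =
      quotientJet (k + 1) (p + 1) (SchwartzMap.derivCLM ℂ ℂ φ) a -
        ((p + 1 : ℕ) : ℂ) * quotientJet (k + 1) (p + 1 + 1) φ a from rfl]
    push_cast at h3 ⊢
    linear_combination h1 - p * h2 - h2 - (k + 1) * h3

/-- Moving `a` moves both the evaluation point, giving one more `τ`-derivative, and the parameter in
the denominator, giving the `-p` term. -/
theorem hasDerivAt_quotientJet (k p : ℕ) (φ : 𝓢(ℝ, ℂ)) {a : ℝ} (ha : a ≠ 0) :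
    HasDerivAt (quotientJet k p φ)
      (quotientJet (k + 1) p φ a - p * quotientJet k (p + 1) φ a) a := by
  induction k generalizing p φ with
  | zero =>
    have ha' : (a : ℂ) ≠ 0 := by exact_mod_cast ha
    have h1 : HasDerivAt (fun a : ℝ => (2 * a : ℂ)) (2 * 1) a :=
      (Complex.ofRealCLM.hasDerivAt (x := a)).const_mul (2 : ℂ)
    refine ((φ.hasDerivAt a).mul ((h1.pow p).inv
      (pow_ne_zero p (mul_ne_zero two_ne_zero ha')))).congr_deriv ?_
    simp only [quotientJet, SchwartzMap.derivCLM_apply, Pi.inv_apply, Pi.pow_apply]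
    rcases p with _ | p
    · simp
    · push_cast
      field_simp
      ring
  | succ k ih =>
    refine ((ih p (SchwartzMap.derivCLM ℂ ℂ φ)).sub ((ih (p + 1) φ).const_mul (p : ℂ))).congr_deriv
      ?_
    rw [show quotientJet (k + 1 + 1) p φ a =
      quotientJet (k + 1) p (SchwartzMap.derivCLM ℂ ℂ φ) a -
        (p : ℂ) * quotientJet (k + 1) (p + 1) φ a from rfl,
      show quotientJet (k + 1) (p + 1) φ a =
      quotientJet k (p + 1) (SchwartzMap.derivCLM ℂ ℂ φ) a -
        ((p + 1 : ℕ) : ℂ) * quotientJet k (p + 1 + 1) φ a from rfl]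
    ring

/-- For `p = k + 1` the lower-order terms cancel, so `(2a)⁻¹ d/da` raises `k` by one. This matches
the recursion of the transformed chain. -/
theorem hasDerivAt_quotientJet_diag (k : ℕ) (φ : 𝓢(ℝ, ℂ)) {a : ℝ} (ha : a ≠ 0) :
    HasDerivAt (quotientJet k (k + 1) φ) (2 * a * quotientJet (k + 1) (k + 2) φ a) a := by
  refine (hasDerivAt_quotientJet k (k + 1) φ ha).congr_deriv ?_
  rw [quotientJet_eq_add k (k + 1) φ ha]
  push_cast
  ring

/-- The Fourier transforms of a chain starting at the odd part of `𝓕 φ`. -/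
theorem fourier_chain_eq_quotientJet {φ : 𝓢(ℝ, ℂ)} {G : ℕ → 𝓢(ℝ, ℂ)}
    (h0 : ∀ r, HasDerivAt (G 0) (-fourierOddPart φ r) r)
    (hsucc : ∀ i r, HasDerivAt (G (i + 1)) (-(r * G i r)) r) (k : ℕ) {ρ : ℝ} (hρ : ρ ≠ 0) :
    (𝓕 (G k) : 𝓢(ℝ, ℂ)) ρ = (-(2 * Real.pi ^ 2 : ℂ)⁻¹) ^ k * (Real.pi * Complex.I)⁻¹ *
      (quotientJet k (k + 1) φ ρ + quotientJet k (k + 1) φ (-ρ)) := by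
  have hπ : (Real.pi : ℂ) ≠ 0 := by exact_mod_cast Real.pi_ne_zero
  induction k generalizing ρ with
  | zero =>
    have hρ' : (ρ : ℂ) ≠ 0 := by exact_mod_cast hρ
    have h := fourier_schwartz_deriv (g' := -fourierOddPart φ) h0 ρ
    rw [FourierTransform.fourier_neg, neg_apply, fourier_fourierOddPart] at h
    simp only [quotientJet]
    have hI := Complex.I_ne_zero
    push_cast
    field_simp
    linear_combination -h
  | succ k ih =>
    have hρ' : (ρ : ℂ) ≠ 0 := by exact_mod_cast hρ
    have h1 := hasDerivAt_fourier_chain hsucc k ρ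
    have hneg : HasDerivAt (fun ρ => quotientJet k (k + 1) φ (-ρ)) _ ρ :=
      (hasDerivAt_quotientJet_diag k φ (neg_ne_zero.2 hρ)).scomp ρ (hasDerivAt_neg ρ)
    have h2 := ((hasDerivAt_quotientJet_diag k φ hρ).add hneg).const_mul
      ((-(2 * Real.pi ^ 2 : ℂ)⁻¹) ^ k * (Real.pi * Complex.I)⁻¹)
    -- Two derivatives of the same function: the chain relation, and the inductive formula, which
    -- holds near `ρ` because `ρ ≠ 0` is an open condition.
    have h3 := h1.unique (h2.congr_of_eventuallyEq
      ((eventually_ne_nhds hρ).mono fun τ hτ => ih hτ))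
    rw [neg_smul, one_smul] at h3
    push_cast at h3
    have h4 : (4 * Real.pi ^ 2 * ρ : ℂ) ≠ 0 := by simp [hπ, hρ']
    refine mul_left_cancel₀ h4 ?_
    rw [pow_succ]
    have h5 : (4 * Real.pi ^ 2 * ρ : ℂ) * (-(2 * Real.pi ^ 2 : ℂ)⁻¹) = -2 * ρ := by
      field_simp
      norm_num
    linear_combination -h3 - (-(2 * Real.pi ^ 2 : ℂ)⁻¹) ^ k * (Real.pi * Complex.I)⁻¹ *
      (quotientJet (k + 1) (k + 1 + 1) φ ρ + quotientJet (k + 1) (k + 1 + 1) φ (-ρ)) * h5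

/-! ### Integer vectors in Euclidean space. -/

section IntVec

variable {d : ℕ}

theorem inner_intVec (m : Fin d → ℤ) (u : EuclideanSpace ℝ (Fin d)) :
    inner ℝ (intVec m) u = ∑ i, (m i : ℝ) * u i := by
  simp [PiLp.inner_apply, intVec, mul_comm]

theorem norm_ofLp_le (u : EuclideanSpace ℝ (Fin d)) : ‖WithLp.ofLp u‖ ≤ ‖u‖ :=
  (pi_norm_le_iff_of_nonneg (norm_nonneg u)).2 fun i => PiLp.norm_apply_le u i

theorem summable_norm_intVec_add_inv_pow (a : EuclideanSpace ℝ (Fin d)) {N : ℕ} (hN : d < N) :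
    Summable fun n : Fin d → ℤ => ‖intVec n + a‖⁻¹ ^ N := by
  refine (summable_norm_sum_smul_sub_inv_pow (EuclideanSpace.basisFun (Fin d) ℝ).toBasis (-a)
    (by simpa using hN)).congr fun n => ?_
  rw [sub_neg_eq_add]
  congr 4
  ext i
  simp [intVec, Finset.sum_apply, Pi.single_apply]

theorem finite_norm_intVec_add_le (a : EuclideanSpace ℝ (Fin d)) (R : ℝ) :
    {n : Fin d → ℤ | ‖intVec n + a‖ ≤ R}.Finite := by
  refine (Set.finite_Icc (fun _ => -⌈R + ‖a‖⌉) (fun _ => ⌈R + ‖a‖⌉)).subset fun n hn => ?_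
  have h : ∀ i, |(n i : ℝ)| ≤ ⌈R + ‖a‖⌉ := fun i => by
    have h1 : ‖intVec n‖ ≤ ‖intVec n + a‖ + ‖a‖ := norm_le_add_norm_add _ _
    have h2 := PiLp.norm_apply_le (intVec n) i
    have hn' : ‖intVec n + a‖ ≤ R := hn
    have h3 := Int.le_ceil (R + ‖a‖)
    change ‖(n i : ℝ)‖ ≤ ‖intVec n‖ at h2
    rw [Real.norm_eq_abs] at h2
    linarith
  exact ⟨fun i => by exact_mod_cast (abs_le.1 (h i)).1, fun i => by exact_mod_cast (abs_le.1 (h i)).2⟩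

end IntVec

/-- Poisson summation for the product of a character with a radial function in odd dimension. -/
theorem IsRadialChain.hasSum_poisson {g : ℕ → ℝ → ℂ} (hg : IsRadialChain g) {j : ℕ} (hj : 0 < j)
    (a b : EuclideanSpace ℝ (Fin (2 * j + 1)))
    (hsum : Summable fun m : Fin (2 * j + 1) → ℤ => 𝓕 (g j) ‖intVec m - b‖) :
    HasSum (fun m : Fin (2 * j + 1) → ℤ => (2 * Real.pi) ^ j * 𝓕 (g j) ‖intVec m - b‖ *
        Complex.exp (2 * Real.pi * Complex.I * (inner ℝ (intVec m) a : ℝ)))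
      (∑' n : Fin (2 * j + 1) → ℤ,
        Complex.exp (2 * Real.pi * Complex.I * (inner ℝ b (a + intVec n) : ℝ)) *
          g 0 ‖a + intVec n‖) := by
  set F : (Fin (2 * j + 1) → ℝ) → ℂ := fun u =>
    Complex.exp (2 * Real.pi * Complex.I * (inner ℝ b (WithLp.toLp 2 u) : ℝ)) *
      g 0 ‖(WithLp.toLp 2 u : EuclideanSpace ℝ (Fin (2 * j + 1)))‖ with hFdef
  have hgc := hg.continuous 0
  have hFc : Continuous F := by fun_prop
  obtain ⟨C, hC⟩ := hg.exists_decay_norm (E := EuclideanSpace ℝ (Fin (2 * j + 1))) 0 (2 * j + 2)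
  have hC0 : 0 ≤ C := by simpa using (norm_nonneg _).trans (hC 0)
  have hF : ∀ u, ‖F u‖ ≤ C * ((1 + ‖u‖) ^ (2 * j + 2))⁻¹ := fun u => by
    have h1 : ‖Complex.exp (2 * Real.pi * Complex.I * (inner ℝ b (WithLp.toLp 2 u) : ℝ))‖ = 1 := by
      rw [show 2 * Real.pi * Complex.I * (inner ℝ b (WithLp.toLp 2 u) : ℝ) =
        ((2 * Real.pi * inner ℝ b (WithLp.toLp 2 u) : ℝ) : ℂ) * Complex.I by push_cast; ring]
      exact Complex.norm_exp_ofReal_mul_I _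
    rw [hFdef, norm_mul, h1, one_mul]
    refine (hC _).trans ?_
    have := norm_ofLp_le (WithLp.toLp 2 u : EuclideanSpace ℝ (Fin (2 * j + 1)))
    gcongr
  -- Multiplying by the character of frequency `b` shifts the transform from `m` to `m - b`.
  have hcoeff : ∀ m : Fin (2 * j + 1) → ℤ,
      ∫ u : Fin (2 * j + 1) → ℝ,
        Complex.exp (-(2 * Real.pi * Complex.I * ∑ i, (m i : ℂ) * u i)) * F u =
      (2 * Real.pi) ^ j * 𝓕 (g j) ‖intVec m - b‖ := fun m => by
    rw [← hg.integral_euclidean_fourier hj, ← (PiLp.volume_preserving_toLp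
      (Fin (2 * j + 1))).integral_comp (MeasurableEquiv.toLp 2 _).measurableEmbedding]
    refine integral_congr_ae (Eventually.of_forall fun u => ?_)
    dsimp only
    rw [hFdef, ← mul_assoc, ← Complex.exp_add, inner_sub_left, inner_intVec]
    congr 2
    push_cast
    ring
  have h := hasSum_fourier_periodization hFc hF (by simp) (by
    simp only [hcoeff]
    exact hsum.mul_left _) (WithLp.ofLp a)
  simp only [hcoeff, periodization] at h
  have hterm : ∀ m : Fin (2 * j + 1) → ℤ,
      ((inner ℝ (intVec m) a : ℝ) : ℂ) = ∑ i, (m i : ℂ) * a i := fun m => by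
    rw [inner_intVec]
    push_cast
    rfl
  simp only [hterm]
  exact h

theorem schwartzFourier_apply_two_pi_mul (φ : 𝓢(ℝ, ℂ)) (r : ℝ) :
    schwartzFourier φ (2 * Real.pi * r) = (𝓕 φ : 𝓢(ℝ, ℂ)) r := by
  simp only [schwartzFourier, ContinuousLinearMap.comp_apply,
    SchwartzMap.compCLMOfContinuousLinearEquiv_apply, Function.comp,
    FourierTransform.fourierCLM_apply, ContinuousLinearEquiv.unitsEquivAut_apply, Units.val_mk0]
  congr 1
  have := Real.pi_ne_zero
  field_simp

/-- The summation formula behind the Fourier transform of `muGM`. -/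
theorem hasSum_quotientJet (k : ℕ) (φ : 𝓢(ℝ, ℂ))
    (z b : EuclideanSpace ℝ (Fin (2 * (k + 1) + 1)))
    (hb : ∀ n : Fin (2 * (k + 1) + 1) → ℤ, intVec n + b ≠ 0)
    (hz : ∀ n : Fin (2 * (k + 1) + 1) → ℤ, z + (2 * Real.pi) • intVec n ≠ 0) :
    HasSum (fun ξ : Fin (2 * (k + 1) + 1) → ℤ =>
        -Complex.I * ((Real.pi : ℂ) ^ (k + 1))⁻¹ *
          Complex.exp (-(Complex.I * (inner ℝ (intVec ξ) z : ℝ))) * ((-1) ^ k *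
            (quotientJet k (k + 1) φ ‖intVec ξ + b‖ + quotientJet k (k + 1) φ (-‖intVec ξ + b‖))))
      (∑' n : Fin (2 * (k + 1) + 1) → ℤ,
        Complex.exp (Complex.I * (inner ℝ b (z + (2 * Real.pi) • intVec n) : ℝ)) /
          ‖z + (2 * Real.pi) • intVec n‖ *
          (schwartzFourier φ ‖z + (2 * Real.pi) • intVec n‖ -
            schwartzFourier φ (-‖z + (2 * Real.pi) • intVec n‖))) := by
  have hπ : (Real.pi : ℂ) ≠ 0 := by exact_mod_cast Real.pi_ne_zero
  obtain ⟨G, hGe, hG0, hGs⟩ := exists_schwartz_chain (fourierOddPart φ) (fourierOddPart_neg φ)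
  obtain ⟨g, hg, hg0, hgk⟩ : ∃ g : ℕ → ℝ → ℂ, IsRadialChain g ∧
      g 0 = dslope (fourierOddPart φ) 0 ∧ g (k + 1) = G k :=
    ⟨_, isRadialChain_of_schwartz (fourierOddPart_neg φ) hGe hG0 hGs, rfl, rfl⟩
  have hF : ∀ m, 𝓕 (g (k + 1)) ‖intVec m - b‖ = (𝓕 (G k) : 𝓢(ℝ, ℂ)) ‖intVec m - b‖ := fun m => by
    rw [hgk, SchwartzMap.fourier_coe]
  have hneg : ∀ ξ : Fin (2 * (k + 1) + 1) → ℤ, intVec (-ξ) = -intVec ξ := fun ξ => by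
    ext i
    simp [intVec]
  have hsub : ∀ m : Fin (2 * (k + 1) + 1) → ℤ, 0 < ‖intVec m - b‖ := fun m => by
    have := hb (-m)
    rw [hneg] at this
    rw [norm_sub_rev]
    exact norm_pos_iff.2 (by rwa [sub_eq_neg_add])
  have hsum : Summable fun m : Fin (2 * (k + 1) + 1) → ℤ => 𝓕 (g (k + 1)) ‖intVec m - b‖ := by
    simp only [hF]
    obtain ⟨C, hC⟩ := (𝓕 (G k) : 𝓢(ℝ, ℂ)).exists_norm_le_inv_one_add_pow (2 * (k + 1) + 2)
    have hC0 : 0 ≤ C := by simpa using (norm_nonneg _).trans (hC 0)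
    refine Summable.of_norm_bounded ((summable_norm_intVec_add_inv_pow (-b)
      (N := 2 * (k + 1) + 2) (by omega)).mul_left C) fun m => (hC _).trans ?_
    have hpos := hsub m
    rw [abs_norm, inv_pow, ← sub_eq_add_neg]
    gcongr
    linarith
  set a : EuclideanSpace ℝ (Fin (2 * (k + 1) + 1)) := (2 * Real.pi)⁻¹ • z with ha
  have hau : ∀ n, z + (2 * Real.pi) • intVec n = (2 * Real.pi) • (a + intVec n) := fun n => by
    rw [smul_add, ha, smul_inv_smul₀ Real.two_pi_pos.ne']
  -- The factor `(2π)⁻¹` comes from `‖z + 2πn‖ = 2π ‖a + n‖` in the denominator. The sum is then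
  -- reindexed by `ξ = -m`, turning `‖m - b‖` into `‖ξ + b‖`.
  have h := (hg.hasSum_poisson k.succ_pos a b hsum).mul_left (2 * Real.pi : ℂ)⁻¹
  rw [← (Equiv.neg _).hasSum_iff, ← tsum_mul_left] at h
  refine Eq.subst (motive := fun s => HasSum _ s) (tsum_congr fun n => Eq.symm ?_)
    (Eq.subst (motive := fun f => HasSum f _) (funext fun ξ => Eq.symm ?_) h)
  rotate_left
  · simp only [Function.comp, Equiv.neg_apply]
    have h1 : ‖intVec (-ξ) - b‖ = ‖intVec ξ + b‖ := by
      rw [hneg, ← norm_neg]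
      congr 1
      abel
    have h2 : 2 * Real.pi * Complex.I * (inner ℝ (intVec (-ξ)) a : ℝ) =
        -(Complex.I * (inner ℝ (intVec ξ) z : ℝ)) := by
      rw [hneg, ha, inner_neg_left, real_inner_smul_right]
      push_cast
      field_simp
    have h3 : (2 * Real.pi : ℂ) ^ k * (-(2 * Real.pi ^ 2 : ℂ)⁻¹) ^ k =
        (-1) ^ k * ((Real.pi : ℂ) ^ k)⁻¹ := by
      rw [← mul_pow, ← inv_pow, ← mul_pow]
      congr 1
      field_simp
    rw [hF, h1, h2, fourier_chain_eq_quotientJet hG0 hGs k (norm_ne_zero_iff.2 (hb ξ)), pow_succ,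
      pow_succ, mul_inv ((Real.pi : ℂ) ^ k), mul_inv (Real.pi : ℂ) Complex.I, Complex.inv_I]
    have h4 : (2 * Real.pi : ℂ)⁻¹ * (2 * Real.pi) = 1 := inv_mul_cancel₀ (by simp [hπ])
    generalize quotientJet k (k + 1) φ ‖intVec ξ + b‖ +
      quotientJet k (k + 1) φ (-‖intVec ξ + b‖) = S
    generalize Complex.exp (-(Complex.I * (inner ℝ (intVec ξ) z : ℝ))) = e
    linear_combination (Complex.I * (Real.pi : ℂ)⁻¹ * S * e) * h3 +
      (Complex.I * (Real.pi : ℂ)⁻¹ * S * e * ((2 * Real.pi : ℂ) ^ k *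
        (-(2 * Real.pi ^ 2 : ℂ)⁻¹) ^ k)) * h4
  · have hne : a + intVec n ≠ 0 := fun h0 => hz n (by rw [hau, h0, smul_zero])
    have hnorm : ‖z + (2 * Real.pi) • intVec n‖ = 2 * Real.pi * ‖a + intVec n‖ := by
      rw [hau, norm_smul, Real.norm_of_nonneg Real.two_pi_pos.le]
    have h1 := mul_dslope_zero (fourierOddPart_neg φ) ‖a + intVec n‖
    rw [fourierOddPart_apply, ← hg0] at h1
    have hn : (‖a + intVec n‖ : ℂ) ≠ 0 := by exact_mod_cast norm_ne_zero_iff.2 hne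
    rw [hnorm, ← mul_neg, schwartzFourier_apply_two_pi_mul, schwartzFourier_apply_two_pi_mul, ← h1,
      hau, real_inner_smul_right]
    push_cast
    rw [show Complex.I * (2 * Real.pi * (inner ℝ b (a + intVec n) : ℝ)) =
      2 * Real.pi * Complex.I * (inner ℝ b (a + intVec n) : ℝ) by ring]
    field_simp

/-! ### Geodesic arcs and the integral of `β` along them. -/

section Arcs

variable {d : ℕ} {x y : EuclideanSpace ℝ (Fin d)}

theorem two_pi_smul_intVec_mem (n : Fin d → ℤ) :
    (2 * Real.pi) • intVec n ∈ periodLattice d :=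
  ⟨n, fun i => by simp [intVec]⟩

theorem proj_eq_iff {a b : EuclideanSpace ℝ (Fin d)} :
    proj a = proj b ↔ ∃ n : Fin d → ℤ, a = b + (2 * Real.pi) • intVec n := by
  rw [eq_comm, proj, proj, QuotientAddGroup.eq]
  constructor
  · rintro ⟨n, hn⟩
    refine ⟨n, ?_⟩
    ext i
    have := hn i
    simp [intVec] at this ⊢
    linarith
  · rintro ⟨n, rfl⟩
    rw [neg_add_cancel_left]
    exact two_pi_smul_intVec_mem n

theorem sub_add_smul_intVec_ne_zero (hxy : proj x ≠ proj y) (n : Fin d → ℤ) :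
    y - x + (2 * Real.pi) • intVec n ≠ 0 := fun h =>
  hxy (proj_eq_iff.2 ⟨n, by rw [← sub_eq_zero, ← neg_eq_zero, ← h]; abel⟩)

/-- The geodesic arc from `x` to `y` whose lift to `ℝ^d` has displacement `y - x + 2πn`. -/
noncomputable def arcOfInt (hxy : proj x ≠ proj y) (n : Fin d → ℤ) : GeodesicArc x y where
  length := ‖y - x + (2 * Real.pi) • intVec n‖
  length_pos := norm_pos_iff.2 (sub_add_smul_intVec_ne_zero hxy n)
  dir := ‖y - x + (2 * Real.pi) • intVec n‖⁻¹ • (y - x + (2 * Real.pi) • intVec n)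
  norm_dir := norm_smul_inv_norm (𝕜 := ℝ) (sub_add_smul_intVec_ne_zero hxy n)
  endpoint := by
    rw [smul_inv_smul₀ (norm_ne_zero_iff.2 (sub_add_smul_intVec_ne_zero hxy n)), proj_eq_iff]
    exact ⟨n, by abel⟩

theorem arcOfInt_length_smul_dir (hxy : proj x ≠ proj y) (n : Fin d → ℤ) :
    (arcOfInt hxy n).length • (arcOfInt hxy n).dir = y - x + (2 * Real.pi) • intVec n :=
  smul_inv_smul₀ (norm_ne_zero_iff.2 (sub_add_smul_intVec_ne_zero hxy n)) _

theorem arcOfInt_bijective (hxy : proj x ≠ proj y) :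
    Function.Bijective (arcOfInt hxy) := by
  refine ⟨fun n m h => ?_, fun γ => ?_⟩
  · have h1 := arcOfInt_length_smul_dir hxy n
    rw [h, arcOfInt_length_smul_dir] at h1
    have h2 := smul_right_injective _ Real.two_pi_pos.ne' (add_left_cancel h1)
    funext i
    have h3 := congrArg (fun v : EuclideanSpace ℝ (Fin d) => v i) h2
    simpa [intVec] using h3.symm
  · obtain ⟨n, hn⟩ := proj_eq_iff.1 γ.endpoint
    have hv : y - x + (2 * Real.pi) • intVec n = γ.length • γ.dir := by
      rw [← sub_eq_zero, ← neg_eq_zero, ← sub_eq_zero.2 hn]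
      abel
    have hlen : ‖y - x + (2 * Real.pi) • intVec n‖ = γ.length := by
      rw [hv, norm_smul, γ.norm_dir, mul_one, Real.norm_of_nonneg γ.length_pos.le]
    refine ⟨n, GeodesicArc.ext hlen ?_⟩
    change ‖y - x + (2 * Real.pi) • intVec n‖⁻¹ • (y - x + (2 * Real.pi) • intVec n) = γ.dir
    rw [hlen, hv, inv_smul_smul₀ γ.length_pos.ne']

/-- Geodesic arcs from `x` to `y` are indexed by `ℤ^d`. -/
noncomputable def arcEquiv (hxy : proj x ≠ proj y) : (Fin d → ℤ) ≃ GeodesicArc x y :=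
  Equiv.ofBijective (arcOfInt hxy) (arcOfInt_bijective hxy)

/-- `β` restricted to the lifted line has the primitive `⟨β₀, t θ⟩ + f(x + t θ)`; periodicity
replaces `f` at the lifted endpoint by `f y`. -/
theorem GeodesicArc.integral_eq {β₀ : EuclideanSpace ℝ (Fin d)} {f : EuclideanSpace ℝ (Fin d) → ℝ}
    (hf : ContDiff ℝ ∞ f) (hfper : ∀ v ∈ periodLattice d, ∀ p, f (p + v) = f p)
    {β : EuclideanSpace ℝ (Fin d) → (EuclideanSpace ℝ (Fin d) →L[ℝ] ℝ)}
    (hβ : ∀ p, β p = innerSL ℝ β₀ + fderiv ℝ f p) (γ : GeodesicArc x y) :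
    γ.integral β = inner ℝ β₀ (γ.length • γ.dir) + (f y - f x) := by
  have hd : ∀ t : ℝ, HasDerivAt (fun t : ℝ => inner ℝ β₀ (t • γ.dir) + f (x + t • γ.dir))
      (β (x + t • γ.dir) γ.dir) t := fun t => by
    have h1 : HasDerivAt (fun t : ℝ => x + t • γ.dir) γ.dir t := by
      simpa using ((hasDerivAt_id t).smul_const γ.dir).const_add x
    have h2 : HasDerivAt (fun t : ℝ => inner ℝ β₀ (t • γ.dir)) (inner ℝ β₀ γ.dir) t := by
      simpa [real_inner_smul_right] using (hasDerivAt_id t).mul_const (inner ℝ β₀ γ.dir)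
    have h3 := (hf.differentiable (by simp) (x + t • γ.dir)).hasFDerivAt.comp_hasDerivAt t h1
    rw [hβ]
    exact h2.add h3
  have hc : Continuous fun t : ℝ => β (x + t • γ.dir) γ.dir := by
    have := hf.continuous_fderiv (by simp)
    simp only [hβ, add_apply]
    fun_prop
  rw [GeodesicArc.integral, intervalIntegral.integral_eq_sub_of_hasDerivAt (fun t _ => hd t)
    (hc.intervalIntegrable _ _)]
  obtain ⟨n, hn⟩ := proj_eq_iff.1 γ.endpoint
  rw [hn, hfper _ (two_pi_smul_intVec_mem n)]
  simp only [zero_smul, inner_zero_right, add_zero]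
  ring

end Arcs

/-! ### Summability and supports of tempered distributions. -/

section Tempered

/-- A family of tempered distributions whose values are dominated by a Schwartz seminorm times a
summable sequence is summable. -/
theorem summable_temperedDistribution {ι : Type*} {T : ι → 𝓢'(ℝ, ℂ)} {u : ι → ℝ} (hu : Summable u)
    (p : ℕ × ℕ) (hT : ∀ i φ, ‖T i φ‖ ≤ u i * schwartzSeminormFamily ℂ ℝ ℂ p φ) : Summable T := by
  have hs : ∀ φ, Summable fun i => T i φ := fun φ =>
    Summable.of_norm_bounded (hu.mul_right _) fun i => hT i φ
  let L : 𝓢(ℝ, ℂ) →L[ℂ] ℂ := SchwartzMap.mkCLMtoNormedSpace (σ := RingHom.id ℂ)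
    (fun φ => ∑' i, T i φ)
    (fun φ ψ => by simp only [map_add]; exact (hs φ).tsum_add (hs ψ))
    (fun c φ => by simp only [map_smul, smul_eq_mul, RingHom.id_apply]; exact tsum_mul_left)
    ⟨{p}, ∑' i, |u i|, tsum_nonneg fun i => abs_nonneg _, fun φ => by
      rw [Finset.sup_singleton]
      refine tsum_of_norm_bounded (hu.abs.hasSum.mul_right _) fun i => (hT i φ).trans ?_
      gcongr
      exact le_abs_self _⟩
  refine ⟨ContinuousLinearMap.toPointwiseConvergenceCLM _ _ _ _ L, ?_⟩
  -- The topology is that of pointwise convergence; the uniform seminorm bound served only to make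
  -- the limit continuous.
  rw [HasSum, PointwiseConvergenceCLM.tendsto_iff_forall_tendsto]
  intro φ
  have h := (hs φ).hasSum
  rw [HasSum] at h
  refine h.congr fun s => ?_
  exact (map_sum (PointwiseConvergenceCLM.evalCLM (RingHom.id ℂ) ℂ φ) T s).symm

theorem IsLocallyFiniteSet.isClosed {S : Set ℝ} (hS : IsLocallyFiniteSet S) : IsClosed S := by
  refine isClosed_of_closure_subset fun t ht => ?_
  have h1 : t ∈ closure (Ioo (-(|t| + 1)) (|t| + 1) ∩ S) :=
    isOpen_Ioo.inter_closure ⟨abs_lt.1 (lt_add_one _), ht⟩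
  have h2 : Ioo (-(|t| + 1)) (|t| + 1) ∩ S ⊆ S ∩ Icc (-(|t| + 1)) (|t| + 1) := fun s hs =>
    ⟨hs.2, Ioo_subset_Icc_self hs.1⟩
  exact ((hS _).isClosed.closure_subset_iff.2 h2 h1).1

/-- The points `±ρ i` form a locally finite, hence closed, set off which `T` vanishes, so it
contains the support. -/
theorem isLocallyFiniteSet_dsupport {ι : Type*} (T : 𝓢'(ℝ, ℂ)) (t : ι → 𝓢(ℝ, ℂ) → ℂ) (ρ : ι → ℝ)
    (hρ : ∀ R, {i | |ρ i| ≤ R}.Finite) (hT : ∀ φ, HasSum (fun i => t i φ) (T φ))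
    (ht : ∀ i (φ : 𝓢(ℝ, ℂ)), (φ =ᶠ[𝓝 (ρ i)] 0) → (φ =ᶠ[𝓝 (-ρ i)] 0) → t i φ = 0) :
    IsLocallyFiniteSet (Distribution.dsupport T) := by
  set S : Set ℝ := range ρ ∪ range (-ρ) with hSdef
  have hS : IsLocallyFiniteSet S := fun R => by
    refine (((hρ R).image ρ).union ((hρ R).image (-ρ))).subset ?_
    rintro s ⟨⟨i, rfl⟩ | ⟨i, rfl⟩, hs⟩
    · exact Or.inl ⟨i, abs_le.2 hs, rfl⟩
    · refine Or.inr ⟨i, ?_, rfl⟩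
      have := abs_le.2 hs
      rwa [Pi.neg_apply, abs_neg] at this
  have hvan : Distribution.IsVanishingOn T Sᶜ := fun φ hφ => by
    have hz : ∀ s ∈ S, φ =ᶠ[𝓝 s] 0 := fun s hs =>
      notMem_tsupport_iff_eventuallyEq.1 fun h => hφ h hs
    refine (hT φ).unique ?_
    have : (fun i => t i φ) = fun _ => 0 := funext fun i =>
      ht i φ (hz _ (Or.inl ⟨i, rfl⟩)) (hz _ (Or.inr ⟨i, rfl⟩))
    rw [this]
    exact hasSum_zero
  intro R
  refine (hS R).subset (inter_subset_inter_left _ fun s hs => ?_)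
  exact (Distribution.mem_dsupport_iff s).1 hs S hvan hS.isClosed

theorem derivDeltaMul_eq_zero (k : ℕ) (a : ℝ) (g : ℝ → ℂ) {φ : 𝓢(ℝ, ℂ)} (h : φ =ᶠ[𝓝 a] 0) :
    derivDeltaMul k a g φ = 0 := by
  have : (fun τ : ℝ => g τ * φ τ) =ᶠ[𝓝 a] fun _ => 0 := h.mono fun τ hτ => by simp [hτ]
  rw [derivDeltaMul, this.iteratedDeriv_eq]
  simp

end Tempered

/-! ### Convergence and support of `μ_GM`. -/

section MuGM

variable {d : ℕ} {x y : EuclideanSpace ℝ (Fin d)}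

theorem muTerm_apply (β : EuclideanSpace ℝ (Fin d) → (EuclideanSpace ℝ (Fin d) →L[ℝ] ℝ))
    (γ : GeodesicArc x y) (φ : 𝓢(ℝ, ℂ)) :
    muTerm β γ φ = Complex.exp (Complex.I * (γ.integral β : ℂ)) / (γ.length : ℂ) *
      (φ γ.length - φ (-γ.length)) := rfl

theorem muTerm_arcEquiv_apply (hxy : proj x ≠ proj y) {β₀ : EuclideanSpace ℝ (Fin d)}
    {f : EuclideanSpace ℝ (Fin d) → ℝ} (hf : ContDiff ℝ ∞ f)
    (hfper : ∀ v ∈ periodLattice d, ∀ p, f (p + v) = f p)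
    {β : EuclideanSpace ℝ (Fin d) → (EuclideanSpace ℝ (Fin d) →L[ℝ] ℝ)}
    (hβ : ∀ p, β p = innerSL ℝ β₀ + fderiv ℝ f p) (n : Fin d → ℤ) (φ : 𝓢(ℝ, ℂ)) :
    muTerm β (arcEquiv hxy n) φ = Complex.exp (Complex.I * ((f y - f x : ℝ) : ℂ)) *
      (Complex.exp (Complex.I * (inner ℝ β₀ (y - x + (2 * Real.pi) • intVec n) : ℝ)) /
        ‖y - x + (2 * Real.pi) • intVec n‖ *
        (φ ‖y - x + (2 * Real.pi) • intVec n‖ - φ (-‖y - x + (2 * Real.pi) • intVec n‖))) := by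
  have hlen : (arcEquiv hxy n).length = ‖y - x + (2 * Real.pi) • intVec n‖ := rfl
  have hdisp : (arcEquiv hxy n).length • (arcEquiv hxy n).dir = y - x + (2 * Real.pi) • intVec n :=
    arcOfInt_length_smul_dir hxy n
  rw [muTerm_apply, GeodesicArc.integral_eq hf hfper hβ, hdisp, hlen, Complex.ofReal_add, mul_add,
    Complex.exp_add]
  ring

/-- One power of `ℓ⁻¹` is the weight and `d` come from the seminorm; the exponent `d + 1` is
summable over `ℤ^d`. -/
theorem norm_muTerm_apply_le (β : EuclideanSpace ℝ (Fin d) → (EuclideanSpace ℝ (Fin d) →L[ℝ] ℝ))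
    (γ : GeodesicArc x y) (φ : 𝓢(ℝ, ℂ)) :
    ‖muTerm β γ φ‖ ≤ 2 * γ.length⁻¹ ^ (d + 1) * schwartzSeminormFamily ℂ ℝ ℂ (d, 0) φ := by
  have hℓ := γ.length_pos
  have h1 : ‖Complex.exp (Complex.I * (γ.integral β : ℂ))‖ = 1 := by
    rw [mul_comm]
    exact Complex.norm_exp_ofReal_mul_I _
  have h2 : ∀ r : ℝ, |r| = γ.length →
      ‖φ r‖ ≤ γ.length⁻¹ ^ d * schwartzSeminormFamily ℂ ℝ ℂ (d, 0) φ := fun r hr => by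
    have := SchwartzMap.norm_pow_mul_le_seminorm ℂ φ d r
    rw [Real.norm_eq_abs, hr] at this
    rw [inv_pow, ← div_eq_inv_mul, le_div_iff₀ (by positivity), mul_comm]
    exact this
  rw [muTerm_apply, norm_mul, norm_div, h1, Complex.norm_real, Real.norm_of_nonneg hℓ.le, one_div]
  calc γ.length⁻¹ * ‖φ γ.length - φ (-γ.length)‖
      ≤ γ.length⁻¹ * (γ.length⁻¹ ^ d * schwartzSeminormFamily ℂ ℝ ℂ (d, 0) φ +
          γ.length⁻¹ ^ d * schwartzSeminormFamily ℂ ℝ ℂ (d, 0) φ) := by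
        gcongr
        exact (norm_sub_le _ _).trans (add_le_add (h2 _ (abs_of_pos hℓ))
          (h2 _ (by rw [abs_neg, abs_of_pos hℓ])))
    _ = _ := by ring

theorem norm_sub_add_smul_intVec (n : Fin d → ℤ) :
    ‖y - x + (2 * Real.pi) • intVec n‖ =
      2 * Real.pi * ‖intVec n + (2 * Real.pi)⁻¹ • (y - x)‖ := by
  rw [← Real.norm_of_nonneg Real.two_pi_pos.le, ← norm_smul, Real.norm_of_nonneg
    Real.two_pi_pos.le, smul_add, smul_inv_smul₀ Real.two_pi_pos.ne', add_comm]

theorem summable_muTerm (hxy : proj x ≠ proj y)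
    (β : EuclideanSpace ℝ (Fin d) → (EuclideanSpace ℝ (Fin d) →L[ℝ] ℝ)) :
    Summable fun γ : GeodesicArc x y => muTerm β γ := by
  refine summable_temperedDistribution (u := fun γ => 2 * γ.length⁻¹ ^ (d + 1)) ?_ (d, 0)
    (norm_muTerm_apply_le β)
  refine Summable.mul_left _ ((arcEquiv hxy).summable_iff.1 ?_)
  refine ((summable_norm_intVec_add_inv_pow ((2 * Real.pi)⁻¹ • (y - x)) d.lt_succ_self).mul_left
    ((2 * Real.pi)⁻¹ ^ (d + 1))).congr fun n => ?_
  change _ = ‖y - x + (2 * Real.pi) • intVec n‖⁻¹ ^ (d + 1)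
  rw [norm_sub_add_smul_intVec, mul_inv (2 * Real.pi), mul_pow]

theorem hasSum_muGM_apply (hxy : proj x ≠ proj y)
    (β : EuclideanSpace ℝ (Fin d) → (EuclideanSpace ℝ (Fin d) →L[ℝ] ℝ)) (φ : 𝓢(ℝ, ℂ)) :
    HasSum (fun n => muTerm β (arcEquiv hxy n) φ) (muGM β x y φ) := by
  have h := (summable_muTerm hxy β).hasSum.mapL
    (PointwiseConvergenceCLM.evalCLM (RingHom.id ℂ) ℂ φ)
  exact (arcEquiv hxy).hasSum_iff.2 h

theorem isLocallyFiniteSet_dsupport_muGM (hxy : proj x ≠ proj y)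
    (β : EuclideanSpace ℝ (Fin d) → (EuclideanSpace ℝ (Fin d) →L[ℝ] ℝ)) :
    IsLocallyFiniteSet (Distribution.dsupport (muGM β x y)) := by
  refine isLocallyFiniteSet_dsupport _ _ (fun n => (arcEquiv hxy n).length) (fun R => ?_)
    (hasSum_muGM_apply hxy β) fun n φ h1 h2 => ?_
  · refine (finite_norm_intVec_add_le ((2 * Real.pi)⁻¹ • (y - x)) ((2 * Real.pi)⁻¹ * R)).subset
      fun n hn => ?_
    have hn' : |‖y - x + (2 * Real.pi) • intVec n‖| ≤ R := hn
    rw [abs_norm, norm_sub_add_smul_intVec] at hn'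
    exact (le_inv_mul_iff₀ Real.two_pi_pos).2 hn'
  · rw [muTerm_apply, h1.eq_of_nhds, h2.eq_of_nhds]
    simp

end MuGM

end GuinandMeyer

theorem propositionp {d : ℕ} (hd : Odd d) (hd3 : 3 ≤ d)
    (x y : EuclideanSpace ℝ (Fin d)) (hxy : GuinandMeyer.proj x ≠ GuinandMeyer.proj y)
    (β₀ : EuclideanSpace ℝ (Fin d)) (hβ₀ : ¬ ∃ n : Fin d → ℤ, β₀ = GuinandMeyer.intVec n)
    (f : EuclideanSpace ℝ (Fin d) → ℝ) (hf : ContDiff ℝ ∞ f)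
    (hfper : ∀ v ∈ GuinandMeyer.periodLattice d, ∀ p, f (p + v) = f p)
    (β : EuclideanSpace ℝ (Fin d) → (EuclideanSpace ℝ (Fin d) →L[ℝ] ℝ))
    (hβ : ∀ p, β p = innerSL ℝ β₀ + fderiv ℝ f p) :
    Summable (fun γ : GuinandMeyer.GeodesicArc x y => GuinandMeyer.muTerm β γ) ∧
    (∀ φ : 𝓢(ℝ, ℂ),
      HasSum
        (fun ξ : Fin d → ℤ =>
          -Complex.I * ((Real.pi ^ ((d - 1) / 2) : ℝ) : ℂ)⁻¹ *
            Complex.exp (Complex.I * ((f y - f x : ℝ) : ℂ)) *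
            (Complex.exp (Complex.I * ((inner ℝ (GuinandMeyer.intVec ξ) (x - y) : ℝ) : ℂ)) *
              (GuinandMeyer.derivDeltaMul ((d - 3) / 2) ‖GuinandMeyer.intVec ξ + β₀‖
                  (fun τ => (((τ + ‖GuinandMeyer.intVec ξ + β₀‖) ^ ((d - 1) / 2) : ℝ) : ℂ)⁻¹) φ +
                GuinandMeyer.derivDeltaMul ((d - 3) / 2) (-‖GuinandMeyer.intVec ξ + β₀‖)
                  (fun τ => (((τ - ‖GuinandMeyer.intVec ξ + β₀‖) ^ ((d - 1) / 2) : ℝ) : ℂ)⁻¹) φ)))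
        (GuinandMeyer.distFourier (GuinandMeyer.muGM β x y) φ)) ∧
    GuinandMeyer.IsCrystalline (GuinandMeyer.muGM β x y) := by
  obtain ⟨k, rfl⟩ : ∃ k, d = 2 * (k + 1) + 1 := by
    obtain ⟨m, rfl⟩ := hd
    exact ⟨m - 1, by omega⟩
  have hk : (2 * (k + 1) + 1 - 3) / 2 = k := by omega
  have hk' : (2 * (k + 1) + 1 - 1) / 2 = k + 1 := by omega
  have hb : ∀ n : Fin (2 * (k + 1) + 1) → ℤ, GuinandMeyer.intVec n + β₀ ≠ 0 := fun n h =>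
    hβ₀ ⟨-n, by
      rw [← neg_eq_iff_add_eq_zero] at h
      rw [← h]
      ext i
      simp [GuinandMeyer.intVec]⟩
  have hfour : ∀ φ : 𝓢(ℝ, ℂ), HasSum
      (fun ξ : Fin (2 * (k + 1) + 1) → ℤ =>
        -Complex.I * ((Real.pi ^ ((2 * (k + 1) + 1 - 1) / 2) : ℝ) : ℂ)⁻¹ *
          Complex.exp (Complex.I * ((f y - f x : ℝ) : ℂ)) *
          (Complex.exp (Complex.I * ((inner ℝ (GuinandMeyer.intVec ξ) (x - y) : ℝ) : ℂ)) *
            (GuinandMeyer.derivDeltaMul ((2 * (k + 1) + 1 - 3) / 2) ‖GuinandMeyer.intVec ξ + β₀‖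
                (fun τ => (((τ + ‖GuinandMeyer.intVec ξ + β₀‖) ^
                  ((2 * (k + 1) + 1 - 1) / 2) : ℝ) : ℂ)⁻¹) φ +
              GuinandMeyer.derivDeltaMul ((2 * (k + 1) + 1 - 3) / 2)
                (-‖GuinandMeyer.intVec ξ + β₀‖)
                (fun τ => (((τ - ‖GuinandMeyer.intVec ξ + β₀‖) ^
                  ((2 * (k + 1) + 1 - 1) / 2) : ℝ) : ℂ)⁻¹) φ)))
      (GuinandMeyer.distFourier (GuinandMeyer.muGM β x y) φ) := fun φ => by
    have h := (GuinandMeyer.hasSum_quotientJet k φ (y - x) β₀ hb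
      (GuinandMeyer.sub_add_smul_intVec_ne_zero hxy)).mul_left
        (Complex.exp (Complex.I * ((f y - f x : ℝ) : ℂ)))
    rw [GuinandMeyer.distFourier_apply, ← (GuinandMeyer.hasSum_muGM_apply hxy β _).tsum_eq]
    rw [← tsum_mul_left] at h
    refine Eq.subst (motive := fun s => HasSum _ s) (tsum_congr fun n => ?_)
      (Eq.subst (motive := fun F => HasSum F _) (funext fun ξ => ?_) h)
    · exact (GuinandMeyer.muTerm_arcEquiv_apply hxy hf hfper hβ n _).symm
    · have hρ : ‖GuinandMeyer.intVec ξ + β₀‖ ≠ 0 := norm_ne_zero_iff.2 (hb ξ)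
      -- Writing `τ - ρ` as `τ + (-ρ)` makes the second Dirac term the same jet at `a = -ρ`.
      simp only [hk, hk', sub_eq_add_neg _ ‖GuinandMeyer.intVec ξ + β₀‖]
      rw [GuinandMeyer.derivDeltaMul_eq_quotientJet _ _ _ hρ,
        GuinandMeyer.derivDeltaMul_eq_quotientJet _ _ _ (neg_ne_zero.2 hρ), ← neg_sub y x,
        inner_neg_right, Complex.ofReal_neg, mul_neg, Complex.ofReal_pow]
      ring
  refine ⟨GuinandMeyer.summable_muTerm hxy β, hfour,
    GuinandMeyer.isLocallyFiniteSet_dsupport_muGM hxy β,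
    GuinandMeyer.isLocallyFiniteSet_dsupport _ _ (fun ξ => ‖GuinandMeyer.intVec ξ + β₀‖)
      (fun R => by simpa using GuinandMeyer.finite_norm_intVec_add_le β₀ R) hfour
      fun ξ φ h1 h2 => ?_⟩
  rw [GuinandMeyer.derivDeltaMul_eq_zero _ _ _ h1, GuinandMeyer.derivDeltaMul_eq_zero _ _ _ h2]
  simp
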